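/- Setting. Macro base stations form a homogeneous Poisson point process $\Phi_1$ of density $\lambda_1>0$ in $\mathbb R^2$; the typical user is at the origin. A base station at $x$ is received with power $P_1 C_1\|x\|^{-\alpha_1}N_1 g_x$, where $P_1,C_1>0$, $\alpha_1>2$, $N_1\ge 1$ is an integer, and the fading gains $g_x$ are i.i.d. exponential with mean $1$, independent of $\Phi_1$ (Rayleigh fading). Let $\Upsilon_1$ be the SINR at the user when it is served by the nearest macro base station $x_0$, i.e. $$\Upsilon_1=\frac{P_1C_1\|x_0\|^{-\alpha_1}N_1g_{x_0}}{\sigma_1^2+\sum_{x\in\Phi_1\setminus\{x_0\}}P_1C_1\|x\|^{-\alpha_1}N_1g_x},\qquad \sigma_1^2\ge 0,$$ and let $P_{\Upsilon_1}(\tau)=\mathbb P[\Upsilon_1>\tau]$ (the coverage probability of the macro tier without caching). The user requests file $f\in\{1,\dots,N_c\}$ with probability $P_f=f^{-\delta}/\sum_{n=1}^{N_c}n^{-\delta}$, $\delta\ge0$, independently of $\Phi_1$ and of the fading. Files $1,\dots,H_c$ (with $H_c\le N_c$) are cached in the network; a file $f$ with $H_c<f\le N_c$ is obtained from the core server via the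 nearest macro base station (server mode) at rate $R_1=\min\big(B_1\log_2(1+\Upsilon_1),C_{bh}\big)$, with bandwidth $B_1>0$ and backhaul capacity $C_{bh}$. Lemma 4. For $R_{th}\ge0$ let $P_S(R_{th})$ be the probability that the requested file $f$ satisfies $H_c<f\le N_c$ and that $R_1\ge R_{th}$. Then $$P_S(R_{th})=\mathbf U(C_{bh}-R_{th})\,\mathbf U(N_c-H_c-1)\sum_{f=H_c+1}^{N_c}P_f\,P_{\Upsilon_1}\big(2^{R_{th}/B_1}-1\big),$$ where $\mathbf U(x)=1$ for $x\ge0$ and $\mathbf U(x)=0$ for $x<0$. Moreover, if $\sigma_1^2=0$, then for every $\tau\ge0$ $$P_{\Upsilon_1}(\tau)=P_{\Upsilon_{1,f}}(\tau)\big|_{p_{1,f}=1},\qquad P_{\Upsilon_{1,f}}(\tau)=\frac{p_{1,f}}{p_{1,f}S_1^0(\tau)+(1-p_{1,f})\Delta_1(\tau)},$$ where $S_1^0(\tau)={}_2F_1\big(-\tfrac{2}{\alpha_1},1;1-\tfrac{2}{\alpha_1};-\tau\big)$ (principal branch of the Gauss hypergeometric function) and $\Delta_1(\tau)=\Gamma\big(1-\tfrac2{\alpha_1}\big)\Gamma\big(1+\tfrac2{\alpha_1}\big)\tau^{2/\alpha_1}$;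 that is, $P_{\Upsilon_1}(\tau)=1/S_1^0(\tau)$. -/

import Mathlib

open MeasureTheory ProbabilityTheory
open scoped ENNReal NNReal

noncomputable section

namespace CacheHetNet

/-- The unit step function, equal to `1` on `[0, ∞)` and to `0` on `(-∞, 0)`. -/
def unitStep (x : ℝ) : ℝ := if 0 ≤ x then 1 else 0

/-- Zipf request probability of the `f`-th most popular of `Nc` files, with skew `δ`. -/
def zipf (δ : ℝ) (Nc f : ℕ) : ℝ :=
  (f : ℝ) ^ (-δ) / ∑ n ∈ Finset.Icc 1 Nc, (n : ℝ) ^ (-δ)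

/-! ### The Gauss hypergeometric function off the cut -/

/-- The complex plane cut along the half-line `[1, ∞)`. -/
def cutPlane : Set ℂ := {z | 1 - z ∈ Complex.slitPlane}

/-- `G` is the principal branch of `₂F₁(a, b; c; ·)`: it is holomorphic on `ℂ ∖ [1, ∞)` and equals
the hypergeometric series on the open unit disc. Since the cut plane is connected, at most one
function on the cut plane has this property. -/
def IsPrincipalGauss (a b c : ℂ) (G : ℂ → ℂ) : Prop :=
  DifferentiableOn ℂ G cutPlane ∧
    ∀ z : ℂ, ‖z‖ < 1 → G z = ordinaryHypergeometric a b c z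

open Classical in
/-- The principal branch of the Gauss hypergeometric function `₂F₁(a, b; c; z)`. Mathlib's
`ordinaryHypergeometric` is the sum of the power series, so it is meaningful only for `‖z‖ < 1`
and does not cover arguments in `(-∞, -1]`. -/
def gauss2F1 (a b c : ℂ) : ℂ → ℂ :=
  if h : ∃ G, IsPrincipalGauss a b c G then h.choose else fun _ => 0

/-- `S^k(z) = ₂F₁(k - 2/α, k + m; k + 1 - 2/α; -z)`, for path loss exponent `α` and Nakagami
parameter `m`. -/
def pathS (α : ℝ) (m k : ℕ) (z : ℝ) : ℝ :=
  (gauss2F1 (((k : ℝ) - 2 / α : ℝ) : ℂ) (((k : ℝ) + m : ℝ) : ℂ)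
    (((k : ℝ) + 1 - 2 / α : ℝ) : ℂ) ((-z : ℝ) : ℂ)).re

/-- `Δ(z) = Γ(1 - 2/α) Γ(m + 2/α) Γ(m)⁻¹ z^(2/α)`. -/
def pathDelta (α : ℝ) (m : ℕ) (z : ℝ) : ℝ :=
  Real.Gamma (1 - 2 / α) * Real.Gamma ((m : ℝ) + 2 / α) * (Real.Gamma (m : ℝ))⁻¹ * z ^ (2 / α)

/-- The closed form of the interference-limited macro-tier coverage probability at threshold `τ`
for a file that each macro base station caches with probability `p` (Rayleigh fading, `m = 1`). -/
def macroCoverageFormula (α p τ : ℝ) : ℝ :=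
  p / (p * pathS α 1 0 τ + (1 - p) * pathDelta α 1 τ)

/-! ### The macro tier -/

/-- The Euclidean plane; the typical user sits at the origin. -/
abbrev Plane : Type := EuclideanSpace ℝ (Fin 2)

/-- Parameters of the macro tier. -/
structure MacroTier where
  /-- density of the base stations -/
  density : ℝ
  /-- transmit power -/
  power : ℝ
  /-- path loss intercept -/
  intercept : ℝ
  /-- path loss exponent -/
  pathExp : ℝ
  /-- number of antenna elements per base station -/
  antennas : ℕ
  /-- thermal noise power `σ²` -/
  noise : ℝ
  density_pos : 0 < density
  power_pos : 0 < power
  intercept_pos : 0 < intercept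
  two_lt_pathExp : 2 < pathExp
  antennas_pos : 0 < antennas
  noise_nonneg : 0 ≤ noise

/-- The path loss law `L(r) = C r^(-α)`. -/
def MacroTier.pathLoss (T : MacroTier) (r : ℝ) : ℝ := T.intercept * r ^ (-T.pathExp)

/-- Power received at the origin from a base station at `x` with fading power gain `|h|² = g`. The
array gain of the omnidirectional macro antennas, and the gain towards the served user, are `1`. -/
def MacroTier.rxPower (T : MacroTier) (x : Plane) (g : ℝ) : ℝ :=
  T.power * T.pathLoss ‖x‖ * (T.antennas * g)

open Classical in
/-- The (first) index of a point of `x` that is nearest to the origin. -/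
def nearestIdx (x : ℕ → Plane) : ℕ :=
  if h : ∃ k, ∀ j, ‖x k‖ ≤ ‖x j‖ then Nat.find h else 0

/-- Total power received from all base stations other than the nearest one. -/
def MacroTier.interference (T : MacroTier) (x : ℕ → Plane) (g : ℕ → ℝ) : ℝ≥0∞ :=
  ∑' k, if k = nearestIdx x then 0 else ENNReal.ofReal (T.rxPower (x k) (g k))

/-- The SINR at the origin when the serving base station is the nearest one and all the others
interfere; it is `0` when the interference is infinite. -/
def MacroTier.sinr (T : MacroTier) (x : ℕ → Plane) (g : ℕ → ℝ) : ℝ :=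
  (ENNReal.ofReal (T.rxPower (x (nearestIdx x)) (g (nearestIdx x))) /
    (ENNReal.ofReal T.noise + T.interference x g)).toReal

/-- Data rate from the core server through the nearest macro base station, with bandwidth `B` and
backhaul capacity `Cbh`. -/
def MacroTier.serverRate (T : MacroTier) (B Cbh : ℝ) (x : ℕ → Plane) (g : ℕ → ℝ) : ℝ :=
  min (B * Real.logb 2 (1 + T.sinr x g)) Cbh

section Probability

variable {Ω : Type*} [MeasurableSpace Ω]

/-- The random points `X 0, X 1, …` enumerate a homogeneous Poisson point process of density `lam`
on the plane: numbers of points in bounded Borel sets are Poisson with mean `lam` times the area,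
and numbers of points in disjoint bounded Borel sets are independent. -/
structure IsHomPoisson (μ : Measure Ω) (lam : ℝ) (X : ℕ → Ω → Plane) : Prop where
  measurable : ∀ k, Measurable (X k)
  count_law : ∀ A : Set Plane, MeasurableSet A → Bornology.IsBounded A →
    HasLaw (fun ω => {k | X k ω ∈ A}.encard)
      ((poissonMeasure (lam * volume.real A).toNNReal).map (fun n : ℕ => (n : ℕ∞))) μ
  count_indep : ∀ (n : ℕ) (A : Fin n → Set Plane), (∀ i, MeasurableSet (A i)) →
    (∀ i, Bornology.IsBounded (A i)) → Pairwise (fun i j => Disjoint (A i) (A j)) →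
    iIndepFun (fun i ω => {k | X k ω ∈ A i}.encard) μ

/-- Rayleigh fading: the power gains `|h|²` of the links are independent and exponentially
distributed with mean `1`. -/
structure IsRayleighFading (μ : Measure Ω) (g : ℕ → Ω → ℝ) : Prop where
  measurable : ∀ k, Measurable (g k)
  law : ∀ k, HasLaw (g k) (expMeasure 1) μ
  indep : iIndepFun g μ

/-- The index of the requested file follows the Zipf law on `{1, …, Nc}`. -/
structure IsZipfRequest (μ : Measure Ω) (δ : ℝ) (Nc : ℕ) (F : Ω → ℕ) : Prop where
  measurable : Measurable F
  mem : ∀ᵐ ω ∂μ, F ω ∈ Finset.Icc 1 Nc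
  law : ∀ f ∈ Finset.Icc 1 Nc, μ.real {ω | F ω = f} = zipf δ Nc f

/-- Coverage probability `ℙ[Υ > τ]` of the macro tier without caching. -/
def macroCoverage (μ : Measure Ω) (T : MacroTier) (X : ℕ → Ω → Plane) (g : ℕ → Ω → ℝ)
    (τ : ℝ) : ℝ :=
  μ.real {ω | τ < T.sinr (fun k => X k ω) (fun k => g k ω)}

/-- Success probability in server mode: the requested file is stored only at the server
(`Hc < F ≤ Nc`), and the server delivers it at a rate that attains `Rth`. -/
def serverSuccess (μ : Measure Ω) (T : MacroTier) (B Cbh : ℝ) (Hc Nc : ℕ)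
    (X : ℕ → Ω → Plane) (g : ℕ → Ω → ℝ) (F : Ω → ℕ) (Rth : ℝ) : ℝ :=
  μ.real {ω | (Hc < F ω ∧ F ω ≤ Nc) ∧
    Rth ≤ T.serverRate B Cbh (fun k => X k ω) (fun k => g k ω)}

end Probability

end CacheHetNet

end

open CacheHetNet

/-! ### The Gauss hypergeometric function on the cut plane -/

namespace CacheHetNet

/-! Server mode. Since the logarithm is monotone, the rate attains `Rth` iff `Rth ≤ Cbh` and the
SINR is at least `2 ^ (Rth / B) - 1`. The request is independent of the pair (points, fading), so
the probability factors. Replacing `≤` by the strict inequality of the coverage probability requires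
that the SINR has no atom at a nonnegative level (`measureReal_le_sinr`). At positive levels this
follows from the continuity of the serving gain. At level `0` it means that the interference is
almost surely finite, which holds because the path loss exponent exceeds `2`.

Coverage without noise. Freeze the points, with nearest norm `r`. The serving gain is exponential
and independent of the interference, so coverage has probability `E exp (-s I)`, which is the
product over interferers of `(1 + τ (r / ‖x j‖) ^ α)⁻¹` (`measure_lt_sinr`). It remains to average
this product over the Poisson process.

The average is computed without a conditional law given the nearest distance. The plane is cut into
annuli carrying `ε` points on average. If the inner disc is empty and the annulus holds exactly one
point, that point is the nearest one and its norm is known up to the width of the annulus.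
Monotonicity in `r` then bounds the product on both sides by functionals of points outside the
annulus, and these are evaluated by the Laplace functional jointly with the count in the annulus
(`lintegral_count_mul_expNeg`, `lintegral_cell`). Annuli with two or more points cost `O(ε ^ 2)`
each. With `c = 1 + interfConst α τ`, both bounds are geometric series, and `ε → 0` squeezes the
average to `1 / c` (`eq_one_div_of_bounds`).

Finally `c` equals `pathS α 1 0 τ`: the integral `eulerGauss` is holomorphic on the cut plane and
has the hypergeometric series on the disc, so it is the principal branch by the identity theorem
(`isPrincipalGauss_eulerGauss`). -/

theorem isOpen_cutPlane : IsOpen cutPlane :=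
  Complex.isOpen_slitPlane.preimage (by fun_prop)

theorem starConvex_cutPlane : StarConvex ℝ 0 cutPlane := by
  intro z hz a b ha hb hab
  have h := Complex.starConvex_one_slitPlane hz ha hb hab
  simp only [cutPlane, Set.mem_ofPred_eq]
  convert h using 1
  simp only [Complex.real_smul, smul_sub, mul_zero, mul_one, zero_add]
  have : (1 : ℂ) = a + b := by exact_mod_cast hab.symm
  linear_combination this

theorem zero_mem_cutPlane : (0 : ℂ) ∈ cutPlane := by simp [cutPlane]

theorem isPreconnected_cutPlane : IsPreconnected cutPlane :=
  (starConvex_cutPlane.isPathConnected zero_mem_cutPlane).isConnected.isPreconnected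

theorem neg_ofReal_mem_cutPlane {τ : ℝ} (hτ : 0 ≤ τ) : ((-τ : ℝ) : ℂ) ∈ cutPlane := by
  simp only [cutPlane, Set.mem_ofPred_eq, Complex.mem_slitPlane_iff]
  left
  simp
  linarith

/-- Identity theorem on the connected cut plane. It makes the choice in `gauss2F1` harmless: any
explicit branch may be used in its place. -/
theorem IsPrincipalGauss.eqOn {a b c : ℂ} {G H : ℂ → ℂ} (hG : IsPrincipalGauss a b c G)
    (hH : IsPrincipalGauss a b c H) : Set.EqOn G H cutPlane := by
  refine AnalyticOnNhd.eqOn_of_preconnected_of_eventuallyEq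
    (hG.1.analyticOnNhd isOpen_cutPlane) (hH.1.analyticOnNhd isOpen_cutPlane)
    isPreconnected_cutPlane zero_mem_cutPlane ?_
  filter_upwards [Metric.ball_mem_nhds (0 : ℂ) one_pos] with z hz
  have hz : ‖z‖ < 1 := by simpa using hz
  rw [hG.2 z hz, hH.2 z hz]

theorem IsPrincipalGauss.gauss2F1_eqOn {a b c : ℂ} {G : ℂ → ℂ} (hG : IsPrincipalGauss a b c G) :
    Set.EqOn (gauss2F1 a b c) G cutPlane := by
  have h : ∃ G, IsPrincipalGauss a b c G := ⟨G, hG⟩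
  rw [gauss2F1, dif_pos h]
  exact h.choose_spec.eqOn hG

/-- The kernel of an Euler-type integral for `₂F₁(-2/α, 1; 1 - 2/α; z)`. -/
noncomputable def eulerKernel (α : ℝ) (z : ℂ) (y : ℝ) : ℂ :=
  ((y ^ (1 - α) : ℝ) : ℂ) * (1 - z * ((y ^ (-α) : ℝ) : ℂ))⁻¹

/-- An Euler-type integral for `₂F₁(-2/α, 1; 1 - 2/α; z)`. -/
noncomputable def eulerGauss (α : ℝ) (z : ℂ) : ℂ :=
  1 - 2 * z * ∫ y in Set.Ioi (1 : ℝ), eulerKernel α z y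

/-- The cut plane is star-shaped about `0`, so `z * v` stays in it and cannot equal `1`. -/
theorem one_sub_mul_ne_zero {z : ℂ} (hz : z ∈ cutPlane) {v : ℝ} (hv : v ∈ Set.Icc (0 : ℝ) 1) :
    1 - z * (v : ℂ) ≠ 0 := by
  have h := starConvex_cutPlane hz (a := 1 - v) (b := v) (by linarith [hv.2]) hv.1 (by ring)
  have := Complex.slitPlane_ne_zero (show 1 - _ ∈ Complex.slitPlane from h)
  simpa [mul_comm] using this

theorem rpow_neg_mem_Icc {α y : ℝ} (hα : 0 < α) (hy : 1 < y) : y ^ (-α) ∈ Set.Icc (0 : ℝ) 1 :=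
  ⟨by positivity, Real.rpow_le_one_of_one_le_of_nonpos hy.le (by linarith)⟩

theorem integrableOn_rpow_one_sub {α : ℝ} (hα : 2 < α) :
    IntegrableOn (fun y : ℝ => y ^ (1 - α)) (Set.Ioi 1) :=
  integrableOn_Ioi_rpow_of_lt (by linarith) one_pos

/-- Compactness of a closed ball times `[0, 1]`. The locally uniform lower bound on the denominator
supplies the dominating function for differentiation under the integral. -/
theorem exists_bound_one_sub_mul {z : ℂ} (hz : z ∈ cutPlane) :
    ∃ c > 0, ∃ ε > 0, ∀ w ∈ Metric.ball z ε, w ∈ cutPlane ∧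
      ∀ v ∈ Set.Icc (0 : ℝ) 1, c ≤ ‖1 - w * (v : ℂ)‖ := by
  obtain ⟨ε, hε, hsub⟩ := Metric.nhds_basis_closedBall.mem_iff.1 (isOpen_cutPlane.mem_nhds hz)
  have hcomp : IsCompact (Metric.closedBall z ε ×ˢ Set.Icc (0 : ℝ) 1) :=
    (isCompact_closedBall z ε).prod isCompact_Icc
  have hcont : Continuous fun p : ℂ × ℝ => ‖1 - p.1 * (p.2 : ℂ)‖ := by fun_prop
  obtain ⟨p, hp, hmin⟩ := hcomp.exists_isMinOn
    ⟨(z, 0), ⟨Metric.mem_closedBall_self hε.le, by simp⟩⟩ hcont.continuousOn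
  refine ⟨_, norm_pos_iff.2 (one_sub_mul_ne_zero (hsub hp.1) hp.2), ε, hε, fun w hw => ?_⟩
  have hw' := Metric.ball_subset_closedBall hw
  exact ⟨hsub hw', fun v hv => hmin (show (w, v) ∈ _ from ⟨hw', hv⟩)⟩

theorem measurable_eulerKernel (α : ℝ) (z : ℂ) : Measurable (eulerKernel α z) := by
  unfold eulerKernel
  fun_prop

theorem norm_eulerKernel_le {α y c : ℝ} {z : ℂ} (hc : 0 < c) (hα : 0 < α) (hy : 1 < y)
    (h : ∀ v ∈ Set.Icc (0 : ℝ) 1, c ≤ ‖1 - z * (v : ℂ)‖) :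
    ‖eulerKernel α z y‖ ≤ y ^ (1 - α) * c⁻¹ := by
  have hy0 : 0 < y := by linarith
  rw [eulerKernel, norm_mul, norm_inv, Complex.norm_real, Real.norm_of_nonneg (by positivity)]
  gcongr
  exact h _ (rpow_neg_mem_Icc hα hy)

theorem integrableOn_eulerKernel {α : ℝ} (hα : 2 < α) {z : ℂ} (hz : z ∈ cutPlane) :
    IntegrableOn (eulerKernel α z) (Set.Ioi 1) := by
  obtain ⟨c, hc, ε, hε, h⟩ := exists_bound_one_sub_mul hz
  refine Integrable.mono' ((integrableOn_rpow_one_sub hα).mul_const c⁻¹)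
    (measurable_eulerKernel α z).aestronglyMeasurable ?_
  filter_upwards [ae_restrict_mem measurableSet_Ioi] with y hy
  exact norm_eulerKernel_le hc (by linarith) hy (h z (Metric.mem_ball_self hε)).2

theorem differentiableOn_eulerGauss {α : ℝ} (hα : 2 < α) :
    DifferentiableOn ℂ (eulerGauss α) cutPlane := by
  intro z hz
  obtain ⟨c, hc, ε, hε, h⟩ := exists_bound_one_sub_mul hz
  have key := hasDerivAt_integral_of_dominated_loc_of_deriv_le
    (μ := volume.restrict (Set.Ioi (1 : ℝ))) (F := eulerKernel α)
    (F' := fun w y => ((y ^ (1 - α) : ℝ) : ℂ) *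
      (((y ^ (-α) : ℝ) : ℂ) / (1 - w * ((y ^ (-α) : ℝ) : ℂ)) ^ 2))
    (bound := fun y => y ^ (1 - α) * (c ^ 2)⁻¹) (x₀ := z) (Metric.ball_mem_nhds z hε)
    (.of_forall fun w => (measurable_eulerKernel α w).aestronglyMeasurable)
    (integrableOn_eulerKernel hα hz) (by fun_prop) ?_
    ((integrableOn_rpow_one_sub hα).mul_const _) ?_
  · refine DifferentiableAt.differentiableWithinAt ?_
    exact (differentiableAt_const _).sub
      (((differentiableAt_const _).mul differentiableAt_id).mul key.2.differentiableAt)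
  · filter_upwards [ae_restrict_mem measurableSet_Ioi] with y hy w hw
    have hy' : (1 : ℝ) < y := hy
    have hy0 : 0 < y := by linarith
    have hv := rpow_neg_mem_Icc (α := α) (by linarith) hy'
    rw [norm_mul, norm_div, norm_pow, Complex.norm_real, Complex.norm_real,
      Real.norm_of_nonneg (by positivity), Real.norm_of_nonneg hv.1, ← one_div]
    gcongr
    · exact hv.2
    · exact (h w hw).2 _ hv
  · filter_upwards [ae_restrict_mem measurableSet_Ioi] with y hy w hw
    have hv := rpow_neg_mem_Icc (α := α) (by linarith) hy
    have hne := one_sub_mul_ne_zero (h w hw).1 hv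
    have h1 : HasDerivAt (fun w : ℂ => 1 - w * ((y ^ (-α) : ℝ) : ℂ)) (-((y ^ (-α) : ℝ) : ℂ)) w := by
      simpa using ((hasDerivAt_id w).mul_const ((y ^ (-α) : ℝ) : ℂ)).const_sub 1
    have h2 := (h1.inv hne).const_mul ((y ^ (1 - α) : ℝ) : ℂ)
    simpa [eulerKernel] using h2

theorem ascPochhammer_eval_mul_sub (a : ℂ) (n : ℕ) :
    (ascPochhammer ℂ n).eval a * (a + n) = a * (ascPochhammer ℂ n).eval (a + 1) := by
  induction n with
  | zero => simp
  | succ n ih =>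
    rw [ascPochhammer_succ_eval, ascPochhammer_succ_eval]
    push_cast
    linear_combination (a + 1 + n) * ih

/-- The symbol `(1)_n` cancels `n!`, and the remaining ratio telescopes by `(a)_n (a + n) = a (a +
1)_n` at `a = -2 / α`. -/
theorem gaussCoeff_eq {α : ℝ} (hα : 2 < α) (n : ℕ) :
    ((n.factorial⁻¹ : ℂ) * (ascPochhammer ℂ n).eval (((((0 : ℕ) : ℝ) - 2 / α : ℝ)) : ℂ) *
      (ascPochhammer ℂ n).eval (((((0 : ℕ) : ℝ) + (1 : ℕ) : ℝ)) : ℂ) *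
      ((ascPochhammer ℂ n).eval (((((0 : ℕ) : ℝ) + 1 - 2 / α : ℝ)) : ℂ))⁻¹) =
      ((2 / (2 - α * n) : ℝ) : ℂ) := by
  have hα0 : α ≠ 0 := by positivity
  have h2 : (2 : ℝ) / α < 1 := (div_lt_one (by linarith)).2 hα
  have hpos : (ascPochhammer ℝ n).eval (1 - 2 / α) ≠ 0 :=
    (ascPochhammer_pos n _ (by linarith)).ne'
  have hmap : ∀ x : ℝ, (ascPochhammer ℂ n).eval (x : ℂ) = ((ascPochhammer ℝ n).eval x : ℝ) := by
    intro x
    rw [← ascPochhammer_map (algebraMap ℝ ℂ), Polynomial.eval_map_algebraMap]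
    exact Polynomial.aeval_algebraMap_apply ℂ x _
  have hne : 2 - α * n ≠ 0 := by
    rcases Nat.eq_zero_or_pos n with rfl | hn
    · simp
    · have : (1 : ℝ) ≤ n := by exact_mod_cast hn
      nlinarith
  have h := ascPochhammer_eval_mul_sub ((-(2 / α) : ℝ) : ℂ) n
  rw [show ((-(2 / α) : ℝ) : ℂ) + 1 = ((1 - 2 / α : ℝ) : ℂ) by push_cast; ring, hmap, hmap] at h
  have h' : (ascPochhammer ℝ n).eval (-(2 / α)) * (-(2 / α) + n) =
      -(2 / α) * (ascPochhammer ℝ n).eval (1 - 2 / α) := by exact_mod_cast h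
  rw [hmap, hmap, hmap]
  have hf : (ascPochhammer ℝ n).eval 1 = n.factorial := ascPochhammer_eval_one ℝ n
  simp only [Nat.cast_zero, Nat.cast_one, zero_add, zero_sub, hf]
  norm_cast
  have hfac : (n.factorial : ℝ) ≠ 0 := by positivity
  have hne' : -(2 / α) + n ≠ 0 := by
    intro h0
    apply hne
    field_simp at h0
    linarith
  have : (ascPochhammer ℝ n).eval (-(2 / α)) =
      2 / (2 - α * n) * (ascPochhammer ℝ n).eval (1 - 2 / α) := by
    rw [← mul_left_inj' hne', h']
    field_simp
    ring
  rw [this]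
  generalize (ascPochhammer ℝ n).eval (1 - 2 / α) = q at hpos
  have hq : (q : ℂ) ≠ 0 := by exact_mod_cast hpos
  have hfac' : (n.factorial : ℂ) ≠ 0 := by exact_mod_cast hfac
  push_cast
  field_simp

theorem integral_rpow_Ioi_one {α : ℝ} (hα : 2 < α) (n : ℕ) :
    ∫ y in Set.Ioi (1 : ℝ), y ^ (1 - α) * (y ^ (-α)) ^ n = 1 / (α * (n + 1) - 2) := by
  have hn : (0 : ℝ) ≤ n := n.cast_nonneg
  rw [setIntegral_congr_fun (g := fun y : ℝ => y ^ (1 - α * (n + 1))) measurableSet_Ioi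
    (fun y hy => ?_), integral_Ioi_rpow_of_lt (by nlinarith) one_pos, Real.one_rpow]
  · rw [neg_div, ← div_neg]
    congr 1
    ring
  · have hy0 : (0 : ℝ) < y := lt_trans one_pos hy
    simp only
    rw [← Real.rpow_natCast, ← Real.rpow_mul hy0.le, ← Real.rpow_add hy0]
    congr 1
    ring

theorem hasSum_eulerKernel_integral {α : ℝ} (hα : 2 < α) {z : ℂ} (hz : ‖z‖ < 1) :
    HasSum (fun n : ℕ => ((1 / (α * (n + 1) - 2) : ℝ) : ℂ) * z ^ n)
      (∫ y in Set.Ioi (1 : ℝ), eulerKernel α z y) := by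
  have key := hasSum_integral_of_dominated_convergence
    (μ := volume.restrict (Set.Ioi (1 : ℝ))) (f := eulerKernel α z)
    (F := fun (n : ℕ) y => ((y ^ (1 - α) * (y ^ (-α)) ^ n : ℝ) : ℂ) * z ^ n)
    (fun n y => y ^ (1 - α) * ‖z‖ ^ n) (fun n => by fun_prop) ?_ ?_ ?_ ?_
  · simpa only [integral_mul_const, integral_complex_ofReal, integral_rpow_Ioi_one hα] using key
  · intro n
    filter_upwards [ae_restrict_mem measurableSet_Ioi] with y hy
    have hy0 : (0 : ℝ) < y := lt_trans one_pos hy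
    have hv := rpow_neg_mem_Icc (α := α) (by linarith) hy
    rw [norm_mul, Complex.norm_real, norm_pow, Real.norm_of_nonneg (by positivity)]
    gcongr
    exact mul_le_of_le_one_right (by positivity) (pow_le_one₀ hv.1 hv.2)
  · exact .of_forall fun y => (summable_geometric_of_lt_one (norm_nonneg z) hz).mul_left _
  · simp only [tsum_mul_left]
    exact (integrableOn_rpow_one_sub hα).mul_const _
  · filter_upwards [ae_restrict_mem measurableSet_Ioi] with y hy
    have hv := rpow_neg_mem_Icc (α := α) (by linarith) hy
    have hlt : ‖z * ((y ^ (-α) : ℝ) : ℂ)‖ < 1 := by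
      rw [norm_mul, Complex.norm_real, Real.norm_of_nonneg hv.1]
      exact (mul_le_of_le_one_right (norm_nonneg z) hv.2).trans_lt hz
    have heq : (fun n : ℕ => ((y ^ (1 - α) * (y ^ (-α)) ^ n : ℝ) : ℂ) * z ^ n) =
        fun n : ℕ => ((y ^ (1 - α) : ℝ) : ℂ) * (z * ((y ^ (-α) : ℝ) : ℂ)) ^ n := by
      funext n
      push_cast
      ring
    rw [heq]
    exact (hasSum_geometric_of_norm_lt_one hlt).mul_left ((y ^ (1 - α) : ℝ) : ℂ)

theorem isPrincipalGauss_eulerGauss {α : ℝ} (hα : 2 < α) :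
    IsPrincipalGauss ((((0 : ℕ) : ℝ) - 2 / α : ℝ) : ℂ) ((((0 : ℕ) : ℝ) + (1 : ℕ) : ℝ) : ℂ)
      ((((0 : ℕ) : ℝ) + 1 - 2 / α : ℝ) : ℂ) (eulerGauss α) := by
  refine ⟨differentiableOn_eulerGauss hα, fun z hz => ?_⟩
  rw [ordinaryHypergeometric_eq_tsum]
  simp only [gaussCoeff_eq hα, smul_eq_mul]
  -- The factor `z` shifts the index by one: the integral accounts for the terms of order at least
  -- one, and the leading `1` of `eulerGauss` is the term of order zero.
  have h := (hasSum_eulerKernel_integral hα hz).mul_left (-(2 * z))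
  let f : ℕ → ℂ := fun n => ((2 / (2 - α * n) : ℝ) : ℂ) * z ^ n
  have heq : (fun n : ℕ => f (n + 1)) =
      fun n : ℕ => -(2 * z) * (((1 / (α * (n + 1) - 2) : ℝ) : ℂ) * z ^ n) := by
    funext n
    have : (2 / (2 - α * (n + 1 : ℕ)) : ℝ) = -2 * (1 / (α * (n + 1) - 2)) := by
      rw [← neg_sub, div_neg]
      push_cast
      ring
    simp only [f]
    rw [this]
    push_cast
    ring
  rw [← heq] at h
  have h0 : f 0 = 1 := by simp [f]
  have htsum : ∑' n, f n = f 0 + -(2 * z) * ∫ y in Set.Ioi (1 : ℝ), eulerKernel α z y :=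
    (HasSum.zero_add (f := f) h).tsum_eq
  rw [h0] at htsum
  rw [eulerGauss]
  refine Eq.trans ?_ htsum.symm
  ring

theorem pathS_eq_integral {α τ : ℝ} (hα : 2 < α) (hτ : 0 ≤ τ) :
    pathS α 1 0 τ = 1 + 2 * τ * ∫ y in Set.Ioi (1 : ℝ), y ^ (1 - α) * (1 + τ * y ^ (-α))⁻¹ := by
  rw [pathS, (isPrincipalGauss_eulerGauss hα).gauss2F1_eqOn (neg_ofReal_mem_cutPlane hτ),
    eulerGauss]
  have : ∀ y : ℝ, eulerKernel α ((-τ : ℝ) : ℂ) y =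
      ((y ^ (1 - α) * (1 + τ * y ^ (-α))⁻¹ : ℝ) : ℂ) := by
    intro y
    simp [eulerKernel]
  simp only [this]
  rw [integral_complex_ofReal]
  norm_cast
  simp

/-! ### The function `s ↦ exp (-s)` on `[0, ∞]` -/

/-- `exp (-s)` for `s ∈ [0, ∞]`, with `exp (-∞) = 0`. -/
noncomputable def expNeg (s : ℝ≥0∞) : ℝ≥0∞ := EReal.exp (-(s : EReal))

@[simp] theorem expNeg_zero : expNeg 0 = 1 := by simp [expNeg]

@[simp] theorem expNeg_top : expNeg ∞ = 0 := by simp [expNeg]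

theorem expNeg_add (a b : ℝ≥0∞) : expNeg (a + b) = expNeg a * expNeg b := by
  rw [expNeg, expNeg, expNeg, ← EReal.exp_add, EReal.coe_ennreal_add,
    EReal.neg_add (.inl (by simp)) (.inr (by simp)), sub_eq_add_neg]

theorem expNeg_antitone : Antitone expNeg := fun a b h =>
  EReal.exp_monotone (EReal.neg_le_neg_iff.2 (by exact_mod_cast h))

theorem expNeg_le_one (a : ℝ≥0∞) : expNeg a ≤ 1 := by
  simpa using expNeg_antitone (zero_le (a := a))

theorem expNeg_ne_top (a : ℝ≥0∞) : expNeg a ≠ ∞ :=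
  ((expNeg_le_one a).trans_lt ENNReal.one_lt_top).ne

theorem continuous_expNeg : Continuous expNeg :=
  ENNReal.continuous_exp.comp (continuous_neg.comp continuous_coe_ennreal_ereal)

theorem measurable_expNeg : Measurable expNeg := continuous_expNeg.measurable

theorem expNeg_ofReal {x : ℝ} (hx : 0 ≤ x) :
    expNeg (ENNReal.ofReal x) = ENNReal.ofReal (Real.exp (-x)) := by
  rw [expNeg, EReal.coe_ennreal_ofReal, max_eq_left hx, ← EReal.coe_neg, EReal.exp_coe]

theorem expNeg_sum {ι : Type*} (s : Finset ι) (a : ι → ℝ≥0∞) :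
    expNeg (∑ i ∈ s, a i) = ∏ i ∈ s, expNeg (a i) := by
  induction s using Finset.cons_induction with
  | empty => simp
  | cons i s hi ih => rw [Finset.sum_cons, Finset.prod_cons, expNeg_add, ih]

theorem expNeg_nat_mul (n : ℕ) (c : ℝ≥0∞) : expNeg (n * c) = expNeg c ^ n := by
  rw [← nsmul_eq_mul, ← Fin.sum_const, expNeg_sum]
  simp

/-- Infinite products of factors in `[0, 1]` are handled as `expNeg` of a series in `[0, ∞]`, so no
summability is needed and divergence simply gives `0`. -/
theorem tendsto_prod_expNeg (a : ℕ → ℝ≥0∞) :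
    Filter.Tendsto (fun n => ∏ i ∈ Finset.range n, expNeg (a i)) Filter.atTop
      (nhds (expNeg (∑' i, a i))) := by
  simp only [← expNeg_sum]
  exact (continuous_expNeg.tendsto _).comp (ENNReal.tendsto_nat_tsum a)

/-! ### Poisson laws -/

theorem lintegral_poissonMeasure (r : ℝ≥0) (φ : ℕ → ℝ≥0∞) :
    ∫⁻ n, φ n ∂poissonMeasure r =
      ∑' n, ENNReal.ofReal (Real.exp (-r) * r ^ n / n.factorial) * φ n := by
  rw [poissonMeasure, lintegral_sum_measure]
  simp

/-- This is the generating function `E t ^ N = exp (-r (1 - t))` at `t = expNeg c`. Allowing `c =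
∞`, that is `t = 0`, later yields void probabilities from the same formula. -/
theorem lintegral_poissonMeasure_expNeg (r : ℝ≥0) (c : ℝ≥0∞) :
    ∫⁻ n, expNeg (n * c) ∂poissonMeasure r = expNeg (r * (1 - expNeg c)) := by
  obtain ⟨t, ht⟩ := WithTop.ne_top_iff_exists.1 (expNeg_ne_top c)
  change (t : ℝ≥0∞) = _ at ht
  have ht1 : t ≤ 1 := by
    have := expNeg_le_one c
    rw [← ht] at this
    exact_mod_cast this
  have hexp : HasSum (fun n : ℕ => Real.exp (-r) * r ^ n / n.factorial * (t : ℝ) ^ n)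
      (Real.exp (-(r * (1 - t)))) := by
    have h := (NormedSpace.expSeries_div_hasSum_exp ((r : ℝ) * t)).mul_left (Real.exp (-r))
    rw [← Real.exp_eq_exp_ℝ, ← Real.exp_add] at h
    have h1 : (fun n : ℕ => Real.exp (-r) * r ^ n / n.factorial * (t : ℝ) ^ n) =
        fun n : ℕ => Real.exp (-r) * (((r : ℝ) * t) ^ n / n.factorial) := by
      funext n
      rw [mul_pow]
      ring
    rw [h1, show -((r : ℝ) * (1 - t)) = -r + r * t by ring]
    exact h
  rw [lintegral_poissonMeasure]
  simp only [expNeg_nat_mul, ← ht]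
  have : ∀ n : ℕ, ENNReal.ofReal (Real.exp (-r) * r ^ n / n.factorial) * (t : ℝ≥0∞) ^ n =
      ENNReal.ofReal (Real.exp (-r) * r ^ n / n.factorial * (t : ℝ) ^ n) := by
    intro n
    rw [ENNReal.ofReal_mul (by positivity), ENNReal.ofReal_pow t.coe_nonneg, ENNReal.ofReal_coe_nnreal]
  simp only [this]
  rw [← ENNReal.ofReal_tsum_of_nonneg (fun n => by positivity) hexp.summable, hexp.tsum_eq,
    ← expNeg_ofReal (mul_nonneg r.coe_nonneg (by simpa using ht1)), ENNReal.ofReal_mul r.coe_nonneg,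
    ENNReal.ofReal_coe_nnreal, ENNReal.ofReal_sub _ t.coe_nonneg]
  simp

/-! ### Counting variables of a point process -/

section Count

variable {Ω : Type*} {X : ℕ → Ω → Plane}

/-- The number of points in `A`. -/
noncomputable def count (X : ℕ → Ω → Plane) (A : Set Plane) (ω : Ω) : ℕ∞ :=
  {k | X k ω ∈ A}.encard

theorem tsum_indicator_eq_count (A : Set Plane) (ω : Ω) :
    ∑' k, A.indicator (fun _ => (1 : ℝ≥0∞)) (X k ω) = (count X A ω : ℝ≥0∞) := by
  rw [count, ← ENNReal.tsum_set_one, tsum_subtype {k | X k ω ∈ A} fun _ => (1 : ℝ≥0∞)]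
  rfl

theorem tsum_simpleFunc_eq_sum_count (f : SimpleFunc Plane ℝ≥0∞) (ω : Ω) :
    ∑' k, f (X k ω) =
      ∑ c ∈ f.range.filter (· ≠ 0), (count X (f ⁻¹' {c}) ω : ℝ≥0∞) * c := by
  have h : ∀ y, f y = ∑ c ∈ f.range.filter (· ≠ 0),
      (f ⁻¹' {c}).indicator (fun _ => (1 : ℝ≥0∞)) y * c := by
    intro y
    by_cases hy : f y = 0
    · rw [Finset.sum_eq_zero, hy]
      intro c hc
      have : y ∉ f ⁻¹' {c} := fun h => (Finset.mem_filter.1 hc).2 (by rw [← h, hy])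
      simp [this]
    · rw [Finset.sum_eq_single (f y)]
      · simp
      · intro c _ hc
        have : y ∉ f ⁻¹' {c} := fun h => hc h.symm
        simp [this]
      · intro hn
        exact absurd (Finset.mem_filter.2 ⟨f.mem_range_self y, hy⟩) hn
  simp only [fun k => h (X k ω)]
  rw [Summable.tsum_finsetSum fun _ _ => ENNReal.summable]
  simp only [ENNReal.tsum_mul_right, tsum_indicator_eq_count]

variable [MeasurableSpace Ω] {μ : Measure Ω} {lam : ℝ}

theorem measurable_count (hX : ∀ k, Measurable (X k)) {A : Set Plane} (hA : MeasurableSet A) :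
    Measurable (count X A) := by
  have h : Measurable fun ω => (count X A ω : ℝ≥0∞) := by
    simp only [← tsum_indicator_eq_count]
    exact Measurable.tsum fun k => (measurable_const.indicator hA).comp (hX k)
  refine measurable_to_countable' fun n => ?_
  have : count X A ⁻¹' {n} = (fun ω => (count X A ω : ℝ≥0∞)) ⁻¹' {(n : ℝ≥0∞)} := by
    ext ω
    simp
  rw [this]
  exact h (measurableSet_singleton _)

theorem IsHomPoisson.lintegral_count (hX : IsHomPoisson μ lam X) {A : Set Plane}
    (hA : MeasurableSet A) (hb : Bornology.IsBounded A) (φ : ℕ∞ → ℝ≥0∞) :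
    ∫⁻ ω, φ (count X A ω) ∂μ = ∫⁻ n : ℕ, φ n ∂poissonMeasure (lam * volume.real A).toNNReal := by
  rw [← lintegral_map (f := φ) measurable_from_top measurable_from_top]
  exact (hX.count_law A hA hb).lintegral_comp measurable_from_top.aemeasurable

theorem IsHomPoisson.lintegral_prod_count (hX : IsHomPoisson μ lam X) {ι : Type*} [Fintype ι]
    (A : ι → Set Plane) (hA : ∀ i, MeasurableSet (A i)) (hb : ∀ i, Bornology.IsBounded (A i))
    (hd : Pairwise fun i j => Disjoint (A i) (A j)) (φ : ι → ℕ∞ → ℝ≥0∞) :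
    ∫⁻ ω, ∏ i, φ i (count X (A i) ω) ∂μ = ∏ i, ∫⁻ ω, φ i (count X (A i) ω) ∂μ := by
  let e := Fintype.equivFin ι
  have h := hX.count_indep _ (fun i => A (e.symm i)) (fun i => hA _) (fun i => hb _)
    fun i j hij => hd (e.symm.injective.ne hij)
  have h' : iIndepFun (fun i ω => count X (A i) ω) μ := by
    simpa [count] using h.precomp e.injective
  exact lintegral_prod_eq_prod_lintegral_of_indepFun Finset.univ _
    (h'.comp φ fun i => measurable_from_top)
    fun i => measurable_from_top.comp (measurable_count hX.measurable (hA i))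

/-- The sum of `f` over the points is a combination of the counts in the fibres of `f` over nonzero
values. These fibres and `B` are disjoint and bounded, so the counts are independent and each
Poisson factor is explicit. -/
theorem IsHomPoisson.lintegral_count_mul_expNeg_simpleFunc (hlam : 0 ≤ lam)
    (hX : IsHomPoisson μ lam X) {B : Set Plane} (hB : MeasurableSet B)
    (hBb : Bornology.IsBounded B) (φ : ℕ∞ → ℝ≥0∞) (f : SimpleFunc Plane ℝ≥0∞)
    (hf : Bornology.IsBounded (Function.support f)) (hfB : ∀ y ∈ B, f y = 0) :
    ∫⁻ ω, φ (count X B ω) * expNeg (∑' k, f (X k ω)) ∂μ =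
      (∫⁻ ω, φ (count X B ω) ∂μ) *
        expNeg (ENNReal.ofReal lam * ∫⁻ y, (1 - expNeg (f y))) := by
  classical
  set s := f.range.filter (· ≠ 0) with hs
  have hs0 : ∀ c : s, (c : ℝ≥0∞) ≠ 0 := fun c => (Finset.mem_filter.1 c.2).2
  -- The index `none` stands for `B`, so that a single independence statement covers `B` together
  -- with the fibres.
  let A : Option s → Set Plane := fun i => i.elim B fun c => f ⁻¹' {(c : ℝ≥0∞)}
  let ψ : Option s → ℕ∞ → ℝ≥0∞ := fun i => i.elim φ fun c n => expNeg ((n : ℝ≥0∞) * c)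
  have hAb : ∀ c : s, Bornology.IsBounded (f ⁻¹' {(c : ℝ≥0∞)}) := fun c =>
    hf.subset fun y hy => by
      have : f y = c := hy
      simp [this, hs0 c]
  have key := hX.lintegral_prod_count A
    (by rintro (_ | c); exacts [hB, f.measurableSet_fiber _])
    (by rintro (_ | c); exacts [hBb, hAb c])
    (by
      have hdis : ∀ c : s, Disjoint B (f ⁻¹' {(c : ℝ≥0∞)}) := fun c =>
        Set.disjoint_left.2 fun y hy hc => hs0 c (by rw [← hfB y hy]; exact hc.symm)
      rintro (_ | c) (_ | d) hcd
      · exact absurd rfl hcd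
      · exact hdis d
      · exact (hdis c).symm
      · refine Set.disjoint_left.2 fun y hy hc => hcd ?_
        congr 1
        ext1
        exact (show f y = c from hy).symm.trans hc)
    ψ
  simp only [Fintype.prod_option, A, ψ, Option.elim] at key
  have hsum : ∀ ω, ∏ c : s, expNeg ((count X (f ⁻¹' {(c : ℝ≥0∞)}) ω : ℝ≥0∞) * c) =
      expNeg (∑' k, f (X k ω)) := by
    intro ω
    rw [tsum_simpleFunc_eq_sum_count, expNeg_sum, ← hs]
    exact Finset.prod_coe_sort s fun c => expNeg ((count X (f ⁻¹' {c}) ω : ℝ≥0∞) * c)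
  simp only [hsum] at key
  rw [key]
  congr 1
  have hfac : ∀ c : s, ∫⁻ ω, expNeg ((count X (f ⁻¹' {(c : ℝ≥0∞)}) ω : ℝ≥0∞) * c) ∂μ =
      expNeg (ENNReal.ofReal lam * ((1 - expNeg c) * volume (f ⁻¹' {(c : ℝ≥0∞)}))) := by
    intro c
    rw [hX.lintegral_count (f.measurableSet_fiber _) (hAb c) fun n => expNeg ((n : ℝ≥0∞) * c)]
    simp only [ENat.toENNReal_coe]
    rw [lintegral_poissonMeasure_expNeg]
    congr 1
    have : ((lam * volume.real (f ⁻¹' {(c : ℝ≥0∞)})).toNNReal : ℝ≥0∞) =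
        ENNReal.ofReal lam * volume (f ⁻¹' {(c : ℝ≥0∞)}) := by
      change ENNReal.ofReal _ = _
      rw [ENNReal.ofReal_mul hlam, measureReal_def, ENNReal.ofReal_toReal]
      exact (hAb c).measure_lt_top.ne
    rw [this]
    ring
  simp only [hfac]
  rw [← expNeg_sum, ← Finset.mul_sum]
  congr 2
  have hmap := SimpleFunc.map_lintegral (μ := (volume : Measure Plane)) (fun c => 1 - expNeg c) f
  rw [← SimpleFunc.lintegral_eq_lintegral] at hmap
  simp only [SimpleFunc.map_apply] at hmap
  rw [hmap, Finset.sum_coe_sort s fun c => (1 - expNeg c) * volume (f ⁻¹' {c}), hs,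
    Finset.sum_filter]
  refine Finset.sum_congr rfl fun c _ => ?_
  by_cases hc : c = 0 <;> simp [hc]

theorem tendsto_tsum_of_monotone {a : ℕ → ℕ → ℝ≥0∞} {b : ℕ → ℝ≥0∞}
    (hm : ∀ k, Monotone fun n => a n k)
    (ha : ∀ k, Filter.Tendsto (fun n => a n k) Filter.atTop (nhds (b k))) :
    Filter.Tendsto (fun n => ∑' k, a n k) Filter.atTop (nhds (∑' k, b k)) := by
  simp only [← lintegral_count]
  exact lintegral_tendsto_of_tendsto_of_monotone (fun n => measurable_from_top.aemeasurable)
    (.of_forall hm) (.of_forall ha)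

/-- The Laplace functional of a homogeneous Poisson process, jointly with the number of points in
a bounded set that is disjoint from the support of the function. -/
theorem IsHomPoisson.lintegral_count_mul_expNeg [IsProbabilityMeasure μ] (hlam : 0 ≤ lam)
    (hX : IsHomPoisson μ lam X) {B : Set Plane} (hB : MeasurableSet B)
    (hBb : Bornology.IsBounded B) {φ : ℕ∞ → ℝ≥0∞} (hφ : ∀ n, φ n ≤ 1) {f : Plane → ℝ≥0∞}
    (hf : Measurable f) (hfB : ∀ y ∈ B, f y = 0) :
    ∫⁻ ω, φ (count X B ω) * expNeg (∑' k, f (X k ω)) ∂μ =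
      (∫⁻ ω, φ (count X B ω) ∂μ) *
        expNeg (ENNReal.ofReal lam * ∫⁻ y, (1 - expNeg (f y))) := by
  -- The law of the counts is only available on bounded sets, hence the truncation to balls. The
  -- truncated functions still increase to `f`, and vanish on `B` with it.
  let F : ℕ → SimpleFunc Plane ℝ≥0∞ := fun n =>
    (SimpleFunc.eapprox f n).restrict (Metric.ball 0 n)
  have hF : ∀ n y, F n y = (Metric.ball (0 : Plane) n).indicator (SimpleFunc.eapprox f n) y :=
    fun n y => SimpleFunc.restrict_apply _ measurableSet_ball y
  have hmono : ∀ y, Monotone fun n => F n y := by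
    intro y m n hmn
    simp only [hF]
    refine (Set.indicator_le_indicator (SimpleFunc.monotone_eapprox f hmn y)).trans ?_
    exact Set.indicator_le_indicator_of_subset
      (Metric.ball_subset_ball (by exact_mod_cast hmn)) (fun _ => zero_le) y
  have hlim : ∀ y, Filter.Tendsto (fun n => F n y) Filter.atTop (nhds (f y)) := by
    intro y
    refine (SimpleFunc.tendsto_eapprox hf y).congr' ?_
    obtain ⟨N, hN⟩ := exists_nat_gt ‖y‖
    filter_upwards [Filter.eventually_ge_atTop N] with n hn
    have : y ∈ Metric.ball (0 : Plane) n := by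
      simpa using hN.trans_le (by exact_mod_cast hn)
    rw [hF, Set.indicator_of_mem this]
  have hle : ∀ n y, F n y ≤ f y := fun n y => (hmono y).ge_of_tendsto (hlim y) n
  have hstep : ∀ n, _ := fun n => hX.lintegral_count_mul_expNeg_simpleFunc hlam hB hBb φ (F n)
    ((Metric.isBounded_ball (x := (0 : Plane)) (r := n)).subset fun y hy => by
      by_contra hn
      exact hy (by rw [hF, Set.indicator_of_notMem hn]))
    (fun y hy => le_antisymm ((hle n y).trans (hfB y hy).le) zero_le)
  have hcm := measurable_count hX.measurable hB
  have hφm : Measurable fun ω => φ (count X B ω) := measurable_from_top.comp hcm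
  refine tendsto_nhds_unique (f := fun n => ∫⁻ ω, φ (count X B ω) * expNeg (∑' k, F n (X k ω)) ∂μ)
    (l := Filter.atTop) ?_ ?_
  · refine tendsto_lintegral_of_dominated_convergence (fun _ => 1) (fun n => ?_) (fun n => ?_)
      (by simp) ?_
    · exact hφm.mul (measurable_expNeg.comp (Measurable.tsum fun k =>
        (F n).measurable.comp (hX.measurable k)))
    · exact .of_forall fun ω => mul_le_one' (hφ _) (expNeg_le_one _)
    · refine .of_forall fun ω => ?_
      refine ENNReal.Tendsto.const_mul ((continuous_expNeg.tendsto _).comp ?_)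
        (.inr ((hφ _).trans_lt ENNReal.one_lt_top).ne)
      exact tendsto_tsum_of_monotone (fun k => hmono _) fun k => hlim _
  · simp only [hstep]
    refine ENNReal.Tendsto.const_mul ((continuous_expNeg.tendsto _).comp ?_) (.inr ?_)
    · refine ENNReal.Tendsto.const_mul ?_ (.inr ENNReal.ofReal_ne_top)
      refine lintegral_tendsto_of_tendsto_of_monotone (fun n => ?_) (.of_forall fun y => ?_)
        (.of_forall fun y => ?_)
      · exact (measurable_const.sub (measurable_expNeg.comp (F n).measurable)).aemeasurable
      · exact fun m n hmn => tsub_le_tsub_left (expNeg_antitone (hmono y hmn)) 1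
      · exact ENNReal.Tendsto.sub tendsto_const_nhds
          ((continuous_expNeg.tendsto _).comp (hlim y)) (.inl ENNReal.one_ne_top)
    · refine ((lintegral_mono fun ω => hφ _).trans_lt ?_).ne
      simp

theorem one_sub_expNeg_le (x : ℝ≥0∞) : 1 - expNeg x ≤ x := by
  rcases eq_or_ne x ∞ with rfl | hx
  · simp
  · rw [← ENNReal.ofReal_toReal hx, expNeg_ofReal ENNReal.toReal_nonneg, ← ENNReal.ofReal_one,
      ← ENNReal.ofReal_sub _ (Real.exp_pos _).le]
    exact ENNReal.ofReal_le_ofReal (by linarith [Real.add_one_le_exp (-x.toReal)])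

/-- Sums of integrable functions over a homogeneous Poisson process are almost surely finite. -/
theorem IsHomPoisson.ae_tsum_ne_top [IsProbabilityMeasure μ] (hlam : 0 ≤ lam)
    (hX : IsHomPoisson μ lam X) {f : Plane → ℝ≥0∞} (hf : Measurable f)
    (hint : ∫⁻ y, f y ≠ ∞) : ∀ᵐ ω ∂μ, ∑' k, f (X k ω) ≠ ∞ := by
  have hS : Measurable fun ω => ∑' k, f (X k ω) :=
    Measurable.tsum fun k => hf.comp (hX.measurable k)
  have hset : MeasurableSet {ω | ∑' k, f (X k ω) ≠ ∞} :=
    (hS (measurableSet_singleton ∞)).compl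
  -- With `S` the sum, `exp (-S / n)` is at most the indicator of `S < ∞`, while its mean is at
  -- least `exp (-lam * ∫ f / n)`, which tends to `1`.
  have hbound : ∀ n : ℕ, expNeg (ENNReal.ofReal lam * ((n : ℝ≥0∞)⁻¹ * ∫⁻ y, f y)) ≤
      μ {ω | ∑' k, f (X k ω) ≠ ∞} := by
    intro n
    have h := hX.lintegral_count_mul_expNeg hlam MeasurableSet.empty Bornology.isBounded_empty
      (φ := fun _ => 1) (fun _ => le_rfl) (hf.const_mul (n : ℝ≥0∞)⁻¹) (by simp)
    simp only [one_mul, ENNReal.tsum_mul_left, lintegral_const, measure_univ, mul_one] at h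
    calc expNeg (ENNReal.ofReal lam * ((n : ℝ≥0∞)⁻¹ * ∫⁻ y, f y))
        ≤ expNeg (ENNReal.ofReal lam * ∫⁻ y, (1 - expNeg ((n : ℝ≥0∞)⁻¹ * f y))) := by
          refine expNeg_antitone (mul_le_mul_right ?_ _)
          rw [← lintegral_const_mul _ hf]
          exact lintegral_mono fun y => one_sub_expNeg_le _
      _ = ∫⁻ ω, expNeg ((n : ℝ≥0∞)⁻¹ * ∑' k, f (X k ω)) ∂μ := h.symm
      _ ≤ ∫⁻ ω, {ω | ∑' k, f (X k ω) ≠ ∞}.indicator 1 ω ∂μ := by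
          refine lintegral_mono fun ω => ?_
          by_cases hω : ∑' k, f (X k ω) = ∞
          · simp [hω, ENNReal.mul_top]
          · rw [Set.indicator_of_mem (by exact hω)]
            exact expNeg_le_one _
      _ = _ := lintegral_indicator_one hset
  have hlim : Filter.Tendsto (fun n : ℕ => expNeg (ENNReal.ofReal lam * ((n : ℝ≥0∞)⁻¹ *
      ∫⁻ y, f y))) Filter.atTop (nhds 1) := by
    have h1 : Filter.Tendsto (fun n : ℕ => ENNReal.ofReal lam * ((n : ℝ≥0∞)⁻¹ * ∫⁻ y, f y))
        Filter.atTop (nhds (ENNReal.ofReal lam * (0 * ∫⁻ y, f y))) :=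
      ENNReal.Tendsto.const_mul (ENNReal.Tendsto.mul_const ENNReal.tendsto_inv_nat_nhds_zero
        (.inr hint)) (.inr ENNReal.ofReal_ne_top)
    have h2 := (continuous_expNeg.tendsto _).comp h1
    simpa [Function.comp_def] using h2
  have hone : μ {ω | ∑' k, f (X k ω) ≠ ∞} = 1 :=
    le_antisymm prob_le_one (le_of_tendsto' hlim hbound)
  exact (prob_compl_eq_zero_iff hset).2 hone

end Count

/-! ### The standard exponential law -/

theorem expMeasure_eq_withDensity (r : ℝ) :
    expMeasure r = volume.withDensity (exponentialPDF r) := rfl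

theorem measurable_exponentialPDF (r : ℝ) : Measurable (exponentialPDF r) :=
  (measurable_exponentialPDFReal r).ennreal_ofReal

theorem expMeasure_one_setOf_lt (y : ℝ≥0∞) : expMeasure 1 {t | y < ENNReal.ofReal t} = expNeg y := by
  have := isProbabilityMeasure_expMeasure one_pos
  rcases eq_or_ne y ∞ with rfl | hy
  · simp
  · have hset : {t : ℝ | y < ENNReal.ofReal t} = (Set.Iic y.toReal)ᶜ := by
      ext t
      simp [ENNReal.lt_ofReal_iff_toReal_lt hy]
    rw [hset, prob_compl_eq_one_sub measurableSet_Iic, ← ofReal_cdf, cdf_expMeasure_eq one_pos,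
      if_pos ENNReal.toReal_nonneg, ← ENNReal.ofReal_one,
      ← ENNReal.ofReal_sub _ (by simp)]
    conv_rhs => rw [← ENNReal.ofReal_toReal hy, expNeg_ofReal ENNReal.toReal_nonneg]
    simp

theorem expMeasure_one_Iic_zero : expMeasure 1 (Set.Iic 0) = 0 := by
  have := isProbabilityMeasure_expMeasure one_pos
  rw [← ofReal_cdf, cdf_expMeasure_eq one_pos]
  simp

theorem expMeasure_one_setOf_eq (y : ℝ≥0∞) : expMeasure 1 {t | ENNReal.ofReal t = y} = 0 := by
  -- For `y = 0` the level set is a whole half-line, because `ENNReal.ofReal` truncates negative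
  -- numbers; the exponential law does not charge it.
  have hsub : {t : ℝ | ENNReal.ofReal t = y} ⊆ Set.Iic 0 ∪ {y.toReal} := by
    intro t ht
    rcases le_or_gt t 0 with h | h
    · exact .inl h
    · right
      rw [← show ENNReal.ofReal t = y from ht]
      simp [ENNReal.toReal_ofReal h.le]
  refine measure_mono_null hsub (measure_union_null expMeasure_one_Iic_zero ?_)
  exact withDensity_absolutelyContinuous _ _ (by simp)

theorem lintegral_expNeg_expMeasure {c : ℝ} (hc : 0 ≤ c) :
    ∫⁻ t, expNeg (ENNReal.ofReal (c * t)) ∂expMeasure 1 =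
      expNeg (ENNReal.ofReal (Real.log (1 + c))) := by
  have hm : Measurable fun t => expNeg (ENNReal.ofReal (c * t)) :=
    measurable_expNeg.comp (by fun_prop)
  rw [expMeasure_eq_withDensity, lintegral_withDensity_eq_lintegral_mul _
    (measurable_exponentialPDF 1) hm]
  have h : ∀ t, (exponentialPDF 1 * fun t => expNeg (ENNReal.ofReal (c * t))) t =
      ENNReal.ofReal (1 + c)⁻¹ * exponentialPDF (1 + c) t := by
    intro t
    rw [Pi.mul_apply]
    rcases lt_or_ge t 0 with ht | ht
    · simp [exponentialPDF_of_neg ht]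
    · rw [exponentialPDF_of_nonneg ht, exponentialPDF_of_nonneg ht, expNeg_ofReal (by positivity),
        ← ENNReal.ofReal_mul (by positivity), ← ENNReal.ofReal_mul (by positivity), one_mul,
        one_mul, ← Real.exp_add, ← mul_assoc, inv_mul_cancel₀ (by positivity), one_mul]
      congr 2
      ring
  simp only [h]
  rw [lintegral_const_mul _ (measurable_exponentialPDF _),
    lintegral_exponentialPDF_eq_one (by linarith), mul_one,
    expNeg_ofReal (Real.log_nonneg (by linarith)), Real.exp_neg, Real.exp_log (by linarith)]

theorem lintegral_ofReal_expMeasure_ne_top : ∫⁻ t, ENNReal.ofReal t ∂expMeasure 1 ≠ ∞ := by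
  rw [expMeasure_eq_withDensity, lintegral_withDensity_eq_lintegral_mul _
    (measurable_exponentialPDF 1) (by fun_prop)]
  -- Comparison with the exponential density of rate `1 / 2`: `t ≤ 2 * exp (t / 2)`, and that
  -- density carries a factor `1 / 2`, whence the `4`.
  have h : ∀ t, (exponentialPDF 1 * fun t => ENNReal.ofReal t) t ≤
      4 * exponentialPDF (1 / 2) t := by
    intro t
    rw [Pi.mul_apply]
    rcases lt_or_ge t 0 with ht | ht
    · simp [exponentialPDF_of_neg ht]
    · rw [exponentialPDF_of_nonneg ht, exponentialPDF_of_nonneg ht,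
        ← ENNReal.ofReal_mul (by positivity), show (4 : ℝ≥0∞) = ENNReal.ofReal 4 by simp,
        ← ENNReal.ofReal_mul (by positivity)]
      refine ENNReal.ofReal_le_ofReal ?_
      have h1 := Real.add_one_le_exp (t / 2)
      have h2 : Real.exp (-(1 / 2 * t)) = Real.exp (-(1 * t)) * Real.exp (t / 2) := by
        rw [← Real.exp_add]
        ring_nf
      rw [h2]
      have := Real.exp_pos (-(1 * t))
      nlinarith
  refine ((lintegral_mono h).trans_lt ?_).ne
  rw [lintegral_const_mul _ (measurable_exponentialPDF _),
    lintegral_exponentialPDF_eq_one (by norm_num)]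
  simp

/-! ### Independent exponential variables -/

section Fading

variable {Ω : Type*} [MeasurableSpace Ω] {μ : Measure Ω} {g : ℕ → Ω → ℝ}

theorem IsRayleighFading.ae_pos (hg : IsRayleighFading μ g) : ∀ᵐ ω ∂μ, ∀ j, 0 < g j ω := by
  rw [ae_all_iff]
  intro j
  have h : μ (g j ⁻¹' Set.Iic 0) = 0 := by
    rw [← Measure.map_apply (hg.measurable j) measurableSet_Iic, (hg.law j).map_eq]
    exact expMeasure_one_Iic_zero
  filter_upwards [measure_eq_zero_iff_ae_notMem.1 h] with ω hω
  simpa using hω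

theorem IsRayleighFading.ae_tsum_ne_top (hg : IsRayleighFading μ g) {c : ℕ → ℝ}
    (hc : ∀ j, 0 ≤ c j) (hsum : ∑' j, ENNReal.ofReal (c j) ≠ ∞) :
    ∀ᵐ ω ∂μ, ∑' j, ENNReal.ofReal (c j * g j ω) ≠ ∞ := by
  have hm : ∀ j, Measurable fun ω => ENNReal.ofReal (c j * g j ω) := fun j =>
    ((hg.measurable j).const_mul _).ennreal_ofReal
  have hint : ∫⁻ ω, ∑' j, ENNReal.ofReal (c j * g j ω) ∂μ ≠ ∞ := by
    rw [lintegral_tsum fun j => (hm j).aemeasurable]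
    have : ∀ j, ∫⁻ ω, ENNReal.ofReal (c j * g j ω) ∂μ =
        ENNReal.ofReal (c j) * ∫⁻ t, ENNReal.ofReal t ∂expMeasure 1 := by
      intro j
      simp only [ENNReal.ofReal_mul (hc j)]
      rw [lintegral_const_mul _ (hg.measurable j).ennreal_ofReal]
      congr 1
      exact (hg.law j).lintegral_comp (f := ENNReal.ofReal) (by fun_prop)
    simp only [this, ENNReal.tsum_mul_right]
    exact ENNReal.mul_ne_top hsum lintegral_ofReal_expMeasure_ne_top
  filter_upwards [ae_lt_top (Measurable.tsum hm) hint] with ω hω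
  exact hω.ne

/-- Fubini on the product law. This replaces conditioning on `Y`: the first variable is frozen at
`ω'` and only the second remains random. -/
theorem measure_setOf_prodMk_mem [IsProbabilityMeasure μ] {α β : Type*} [MeasurableSpace α] [MeasurableSpace β]
    {Y : Ω → α} {Z : Ω → β} (hY : Measurable Y) (hZ : Measurable Z) (h : IndepFun Y Z μ)
    {S : Set (α × β)} (hS : MeasurableSet S) :
    μ {ω | (Y ω, Z ω) ∈ S} = ∫⁻ ω', μ {ω | (Y ω', Z ω) ∈ S} ∂μ := by
  have hmap := (indepFun_iff_map_prod_eq_prod_map_map hY.aemeasurable hZ.aemeasurable).1 h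
  have := Measure.isProbabilityMeasure_map (μ := μ) hZ.aemeasurable
  have h1 : μ {ω | (Y ω, Z ω) ∈ S} = μ.map (fun ω => (Y ω, Z ω)) S :=
    (Measure.map_apply (hY.prodMk hZ) hS).symm
  rw [h1, hmap, Measure.prod_apply hS, lintegral_map (measurable_measure_prodMk_left hS) hY]
  refine lintegral_congr fun ω' => ?_
  rw [Measure.map_apply hZ (measurable_prodMk_left hS)]
  rfl

theorem measure_lt_ofReal_exponential [IsProbabilityMeasure μ] {Y : Ω → ℝ≥0∞} {Z : Ω → ℝ} (hY : Measurable Y)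
    (hZ : Measurable Z) (hlaw : HasLaw Z (expMeasure 1) μ) (h : IndepFun Y Z μ) :
    μ {ω | Y ω < ENNReal.ofReal (Z ω)} = ∫⁻ ω, expNeg (Y ω) ∂μ := by
  have hS : MeasurableSet {p : ℝ≥0∞ × ℝ | p.1 < ENNReal.ofReal p.2} :=
    measurableSet_lt measurable_fst (by fun_prop)
  refine (measure_setOf_prodMk_mem hY hZ h hS).trans (lintegral_congr fun ω' => ?_)
  rw [← expMeasure_one_setOf_lt, ← hlaw.map_eq, Measure.map_apply hZ]
  · rfl
  · exact measurableSet_lt measurable_const (by fun_prop)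

theorem measure_ofReal_exponential_eq [IsProbabilityMeasure μ] {Y : Ω → ℝ≥0∞} {Z : Ω → ℝ} (hY : Measurable Y)
    (hZ : Measurable Z) (hlaw : HasLaw Z (expMeasure 1) μ) (h : IndepFun Y Z μ) :
    μ {ω | ENNReal.ofReal (Z ω) = Y ω} = 0 := by
  have hS : MeasurableSet {p : ℝ≥0∞ × ℝ | ENNReal.ofReal p.2 = p.1} :=
    measurableSet_eq_fun (by fun_prop) measurable_fst
  refine (measure_setOf_prodMk_mem hY hZ h hS).trans ?_
  rw [← lintegral_zero (μ := μ)]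
  refine lintegral_congr fun ω' => ?_
  rw [← expMeasure_one_setOf_eq (Y ω'), ← hlaw.map_eq, Measure.map_apply hZ]
  · rfl
  · exact measurableSet_eq_fun (by fun_prop) measurable_const

theorem measurable_tsum_ennreal {α : Type*} {m : MeasurableSpace α} {f : ℕ → α → ℝ≥0∞}
    (hf : ∀ j, Measurable (f j)) : Measurable fun a => ∑' j, f j a :=
  Measurable.tsum hf

/-- As `c k = 0`, the series is measurable with respect to the gains of index other than `k`. This
separates the interference from the serving gain. -/
theorem IsRayleighFading.indepFun_tsum (hg : IsRayleighFading μ g) {k : ℕ} {c : ℕ → ℝ}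
    (hc : c k = 0) : IndepFun (fun ω => ∑' j, ENNReal.ofReal (c j * g j ω)) (g k) μ := by
  have hind := indep_iSup_of_disjoint (fun n => (hg.measurable n).comap_le) hg.indep
    (disjoint_compl_left (a := ({k} : Set ℕ)))
  refine indep_of_indep_of_le_left (indep_of_indep_of_le_right hind ?_) ?_
  · exact le_iSup₂_of_le k rfl le_rfl
  · rw [← measurable_iff_comap_le]
    refine measurable_tsum_ennreal fun j => ?_
    rcases eq_or_ne j k with rfl | hj
    · simp only [hc, zero_mul]
      exact measurable_const
    · have hf : Measurable fun t : ℝ => ENNReal.ofReal (c j * t) := by fun_prop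
      refine hf.comp (measurable_iff_comap_le.2 ?_)
      exact le_iSup₂_of_le j hj le_rfl

/-- Each gain contributes its Laplace transform `(1 + c j)⁻¹`. Independence gives the finite
products, and dominated convergence passes to the infinite one. -/
theorem IsRayleighFading.lintegral_expNeg_tsum [IsProbabilityMeasure μ] (hg : IsRayleighFading μ g) {c : ℕ → ℝ}
    (hc : ∀ j, 0 ≤ c j) :
    ∫⁻ ω, expNeg (∑' j, ENNReal.ofReal (c j * g j ω)) ∂μ =
      expNeg (∑' j, ENNReal.ofReal (Real.log (1 + c j))) := by
  have hm : ∀ j, Measurable fun t => expNeg (ENNReal.ofReal (c j * t)) := fun j =>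
    measurable_expNeg.comp (by fun_prop)
  refine tendsto_nhds_unique
    (f := fun n => ∫⁻ ω, ∏ j ∈ Finset.range n, expNeg (ENNReal.ofReal (c j * g j ω)) ∂μ)
    (l := Filter.atTop) ?_ ?_
  · refine tendsto_lintegral_of_dominated_convergence (fun _ => 1) (fun n => ?_) (fun n => ?_)
      (by simp) ?_
    · exact Finset.measurable_fun_prod _ fun j _ => (hm j).comp (hg.measurable j)
    · exact .of_forall fun ω => Finset.prod_le_one' fun j _ => expNeg_le_one _
    · exact .of_forall fun ω => tendsto_prod_expNeg _
  · have h : ∀ n, ∫⁻ ω, ∏ j ∈ Finset.range n, expNeg (ENNReal.ofReal (c j * g j ω)) ∂μ =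
        ∏ j ∈ Finset.range n, expNeg (ENNReal.ofReal (Real.log (1 + c j))) := by
      intro n
      refine (lintegral_prod_eq_prod_lintegral_of_indepFun (Finset.range n) _
        (hg.indep.comp (fun j t => expNeg (ENNReal.ofReal (c j * t))) hm)
        fun j => (hm j).comp (hg.measurable j)).trans ?_
      refine Finset.prod_congr rfl fun j _ => ?_
      rw [← lintegral_expNeg_expMeasure (hc j)]
      exact (hg.law j).lintegral_comp (hm j).aemeasurable
    simp only [h]
    exact tendsto_prod_expNeg _

/-! ### The SINR for fixed base stations -/

/-- Mean power received from `y`. -/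
noncomputable def MacroTier.gain (T : MacroTier) (y : Plane) : ℝ :=
  T.power * T.pathLoss ‖y‖ * T.antennas

theorem MacroTier.rxPower_eq (T : MacroTier) (y : Plane) (t : ℝ) :
    T.rxPower y t = T.gain y * t := by
  rw [rxPower, gain]
  ring

theorem MacroTier.gain_nonneg (T : MacroTier) (y : Plane) : 0 ≤ T.gain y := by
  have := T.power_pos.le
  have := T.intercept_pos.le
  unfold gain pathLoss
  positivity

theorem MacroTier.gain_pos (T : MacroTier) {y : Plane} (hy : y ≠ 0) : 0 < T.gain y := by
  have := T.power_pos
  have := T.intercept_pos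
  have : (0 : ℝ) < T.antennas := by exact_mod_cast T.antennas_pos
  have := norm_pos_iff.2 hy
  unfold gain pathLoss
  positivity

theorem MacroTier.gain_div_gain (T : MacroTier) {y z : Plane} (hy : y ≠ 0) (hz : z ≠ 0) :
    T.gain y / T.gain z = (‖z‖ / ‖y‖) ^ T.pathExp := by
  have := T.power_pos
  have := T.intercept_pos
  have : (0 : ℝ) < T.antennas := by exact_mod_cast T.antennas_pos
  have hy' := norm_pos_iff.2 hy
  have hz' := norm_pos_iff.2 hz
  rw [Real.div_rpow hz'.le hy'.le, gain, gain, pathLoss, pathLoss, Real.rpow_neg hy'.le,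
    Real.rpow_neg hz'.le]
  field_simp

/-- Gains of the interferers. -/
noncomputable def MacroTier.interfGain (T : MacroTier) (x : ℕ → Plane) (j : ℕ) : ℝ :=
  if j = nearestIdx x then 0 else T.gain (x j)

theorem MacroTier.interfGain_nonneg (T : MacroTier) (x : ℕ → Plane) (j : ℕ) :
    0 ≤ T.interfGain x j := by
  unfold interfGain
  split_ifs
  exacts [le_rfl, T.gain_nonneg _]

theorem MacroTier.interference_eq (T : MacroTier) (x : ℕ → Plane) (t : ℕ → ℝ) :
    T.interference x t = ∑' j, ENNReal.ofReal (T.interfGain x j * t j) := by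
  rw [interference]
  refine tsum_congr fun j => ?_
  rw [interfGain, rxPower_eq]
  split_ifs <;> simp

theorem MacroTier.interference_ne_zero (T : MacroTier) {x : ℕ → Plane} (hx : ∀ j, x j ≠ 0)
    {t : ℕ → ℝ} (ht : ∀ j, 0 < t j) : T.interference x t ≠ 0 := by
  intro h
  rw [interference, ENNReal.tsum_eq_zero] at h
  -- Any index other than the serving one would do; an enumeration by `ℕ` always provides an
  -- interferer, so the denominator of the SINR never vanishes.
  have h' := h (nearestIdx x + 1)
  rw [if_neg (by simp), rxPower_eq, ENNReal.ofReal_eq_zero] at h'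
  exact h'.not_gt (mul_pos (T.gain_pos (hx _)) (ht _))

/-- Solves the coverage inequality for the serving gain, which isolates the variable that is
independent of the interference. -/
theorem MacroTier.lt_sinr_iff (T : MacroTier) {x : ℕ → Plane} (hx : ∀ j, x j ≠ 0)
    {t : ℕ → ℝ} (ht : ∀ j, 0 < t j) {τ : ℝ} (hτ : 0 < τ) :
    τ < T.sinr x t ↔ ENNReal.ofReal (τ / T.gain (x (nearestIdx x))) *
      (ENNReal.ofReal T.noise + T.interference x t) < ENNReal.ofReal (t (nearestIdx x)) := by
  have hI := T.interference_ne_zero hx ht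
  have hA := T.gain_pos (hx (nearestIdx x))
  have hA' : ENNReal.ofReal (T.gain (x (nearestIdx x))) ≠ 0 := by simpa using hA
  rw [sinr, ← ENNReal.ofReal_lt_iff_lt_toReal hτ.le
    (ENNReal.div_ne_top ENNReal.ofReal_ne_top (by simp [hI])),
    ENNReal.lt_div_iff_mul_lt (.inl (by simp [hI])) (.inr (by simpa using hτ)), rxPower_eq,
    ENNReal.ofReal_mul hA.le, ENNReal.ofReal_div_of_pos hA, ENNReal.div_eq_inv_mul, mul_assoc,
    ← ENNReal.div_eq_inv_mul, ENNReal.div_lt_iff (.inl hA') (.inl ENNReal.ofReal_ne_top),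
    mul_comm (ENNReal.ofReal (t _))]

theorem MacroTier.eq_of_sinr_eq (T : MacroTier) {x : ℕ → Plane} (hx : ∀ j, x j ≠ 0)
    {t : ℕ → ℝ} {τ : ℝ} (hτ : 0 < τ) (h : T.sinr x t = τ) :
    ENNReal.ofReal (t (nearestIdx x)) = ENNReal.ofReal (τ / T.gain (x (nearestIdx x))) *
      (ENNReal.ofReal T.noise + T.interference x t) := by
  have hA := T.gain_pos (hx (nearestIdx x))
  have hA' : ENNReal.ofReal (T.gain (x (nearestIdx x))) ≠ 0 := by simpa using hA
  rw [sinr] at h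
  have hne : ∀ a : ℝ≥0∞, a.toReal = τ → a = ENNReal.ofReal τ ∧ a ≠ 0 ∧ a ≠ ∞ := by
    rintro a rfl
    have := ENNReal.toReal_pos_iff.1 hτ
    exact ⟨(ENNReal.ofReal_toReal this.2.ne).symm, this.1.ne', this.2.ne⟩
  obtain ⟨h1, h2, h3⟩ := hne _ h
  rw [Ne, ENNReal.div_eq_zero_iff, not_or] at h2
  have hD0 : ENNReal.ofReal T.noise + T.interference x t ≠ 0 := fun h0 => by
    rw [h0, ENNReal.div_zero h2.1] at h3
    exact h3 rfl
  have h1 := (ENNReal.eq_div_iff hD0 h2.2).1 h1.symm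
  rw [mul_comm, rxPower_eq, ENNReal.ofReal_mul hA.le] at h1
  rw [ENNReal.ofReal_div_of_pos hA, ENNReal.div_eq_inv_mul, mul_assoc, h1, ← mul_assoc, ENNReal.inv_mul_cancel hA' ENNReal.ofReal_ne_top, one_mul]

/-- The exponent of the interference factor at threshold `τ` when the nearest point has norm `r`. -/
noncomputable def logFactor (α τ r : ℝ) (y : Plane) : ℝ≥0∞ :=
  ENNReal.ofReal (Real.log (1 + τ * (r / ‖y‖) ^ α))

/-- The tail of the serving gain turns coverage into a Laplace transform of the interference. The
transmit power, intercept and antenna number cancel in the ratios of mean gains. Minimality of the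
serving index plays no role here; it enters only in the average over the points. -/
theorem measure_lt_sinr [IsProbabilityMeasure μ] (hg : IsRayleighFading μ g) {T : MacroTier} (hT : T.noise = 0)
    {x : ℕ → Plane} (hx : ∀ j, x j ≠ 0) {τ : ℝ} (hτ : 0 < τ) :
    μ {ω | τ < T.sinr x fun k => g k ω} = expNeg (∑' j, if j = nearestIdx x then 0 else
      logFactor T.pathExp τ ‖x (nearestIdx x)‖ (x j)) := by
  set k := nearestIdx x with hk
  have hA := T.gain_pos (hx k)
  let c : ℕ → ℝ := fun j => τ / T.gain (x k) * T.interfGain x j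
  have hc : ∀ j, 0 ≤ c j := fun j => mul_nonneg (by positivity) (T.interfGain_nonneg x j)
  have hck : c k = 0 := by simp [c, MacroTier.interfGain, hk]
  have hY : Measurable fun ω => ∑' j, ENNReal.ofReal (c j * g j ω) :=
    Measurable.tsum fun j => ((hg.measurable j).const_mul _).ennreal_ofReal
  have h1 : μ {ω | τ < T.sinr x fun k => g k ω} =
      μ {ω | ∑' j, ENNReal.ofReal (c j * g j ω) < ENNReal.ofReal (g k ω)} := by
    refine measure_congr ?_
    filter_upwards [hg.ae_pos] with ω hω
    have h := T.lt_sinr_iff hx hω hτ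
    rw [hT, ENNReal.ofReal_zero, zero_add, T.interference_eq, ← ENNReal.tsum_mul_left] at h
    have h2 : ∀ j, ENNReal.ofReal (τ / T.gain (x k)) * ENNReal.ofReal (T.interfGain x j * g j ω) =
        ENNReal.ofReal (c j * g j ω) := by
      intro j
      rw [← ENNReal.ofReal_mul (by positivity)]
      simp only [c, mul_assoc]
    simp only [← hk, h2] at h
    exact propext h
  rw [h1, measure_lt_ofReal_exponential hY (hg.measurable k) (hg.law k) (hg.indepFun_tsum hck),
    hg.lintegral_expNeg_tsum hc]
  congr 1
  refine tsum_congr fun j => ?_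
  simp only [c, MacroTier.interfGain, ← hk]
  split_ifs with hj
  · simp
  · rw [logFactor, ← T.gain_div_gain (hx j) (hx k)]
    congr 3
    ring

/-- Equality would force the serving gain to equal a quantity independent of it, which an atomless
law excludes. -/
theorem measure_sinr_eq [IsProbabilityMeasure μ] (hg : IsRayleighFading μ g) (T : MacroTier)
    {x : ℕ → Plane} (hx : ∀ j, x j ≠ 0) {τ : ℝ} (hτ : 0 < τ) :
    μ {ω | (T.sinr x fun k => g k ω) = τ} = 0 := by
  set k := nearestIdx x with hk
  have hck : T.interfGain x k = 0 := by simp [MacroTier.interfGain, hk]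
  have hY : Measurable fun ω => ∑' j, ENNReal.ofReal (T.interfGain x j * g j ω) :=
    Measurable.tsum fun j => ((hg.measurable j).const_mul _).ennreal_ofReal
  have hφ : Measurable fun s : ℝ≥0∞ => ENNReal.ofReal (τ / T.gain (x k)) *
      (ENNReal.ofReal T.noise + s) := by fun_prop
  refine measure_mono_null (fun ω hω => ?_) (measure_ofReal_exponential_eq (hφ.comp hY)
    (hg.measurable k) (hg.law k) ((hg.indepFun_tsum hck).comp hφ measurable_id))
  have h := T.eq_of_sinr_eq hx hτ hω
  rw [T.interference_eq] at h
  exact h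

theorem ae_sinr_pos (hg : IsRayleighFading μ g) (T : MacroTier)
    {x : ℕ → Plane} (hx : ∀ j, x j ≠ 0) (hsum : ∑' j, ENNReal.ofReal (T.gain (x j)) ≠ ∞) :
    ∀ᵐ ω ∂μ, 0 < T.sinr x fun k => g k ω := by
  have hsum' : ∑' j, ENNReal.ofReal (T.interfGain x j) ≠ ∞ := by
    refine ne_top_of_le_ne_top hsum (ENNReal.tsum_le_tsum fun j => ENNReal.ofReal_le_ofReal ?_)
    unfold MacroTier.interfGain
    split_ifs
    exacts [T.gain_nonneg _, le_rfl]
  filter_upwards [hg.ae_pos, hg.ae_tsum_ne_top (T.interfGain_nonneg x) hsum'] with ω hpos hfin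
  rw [← T.interference_eq] at hfin
  have hI := T.interference_ne_zero hx hpos
  rw [MacroTier.sinr]
  refine ENNReal.toReal_pos ?_ (ENNReal.div_ne_top ENNReal.ofReal_ne_top (by simp [hI]))
  rw [Ne, ENNReal.div_eq_zero_iff, not_or]
  refine ⟨?_, ENNReal.add_ne_top.2 ⟨ENNReal.ofReal_ne_top, hfin⟩⟩
  rw [T.rxPower_eq]
  simpa using mul_pos (T.gain_pos (hx _)) (hpos _)

end Fading

/-! ### Intensity integrals in the plane -/

theorem volume_ball_plane {r : ℝ} (hr : 0 ≤ r) :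
    volume (Metric.ball (0 : Plane) r) = ENNReal.ofReal (Real.pi * r ^ 2) := by
  rw [EuclideanSpace.volume_ball_fin_two, ← ENNReal.ofReal_pow hr, mul_comm (Real.pi),
    ENNReal.ofReal_mul (by positivity)]

theorem volume_annulus {r s : ℝ} (hr : 0 ≤ r) (hrs : r ≤ s) :
    volume (Metric.ball (0 : Plane) s \ Metric.ball 0 r) =
      ENNReal.ofReal (Real.pi * (s ^ 2 - r ^ 2)) := by
  rw [measure_sdiff (Metric.ball_subset_ball hrs) measurableSet_ball.nullMeasurableSet
    measure_ball_lt_top.ne, volume_ball_plane hr, volume_ball_plane (hr.trans hrs),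
    ← ENNReal.ofReal_sub _ (by positivity), mul_sub]

/-- The restriction of the interference exponent to points outside the ball of radius `b`. -/
noncomputable def outerFactor (α τ a b : ℝ) : Plane → ℝ≥0∞ :=
  (Metric.ball (0 : Plane) b)ᶜ.indicator (logFactor α τ a)

theorem measurable_logFactor (α τ a : ℝ) : Measurable (logFactor α τ a) := by
  unfold logFactor
  fun_prop

theorem measurable_outerFactor (α τ a b : ℝ) : Measurable (outerFactor α τ a b) :=
  (measurable_logFactor α τ a).indicator measurableSet_ball.compl

theorem outerFactor_of_mem {α τ a b : ℝ} {y : Plane} (hy : y ∈ Metric.ball (0 : Plane) b) :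
    outerFactor α τ a b y = 0 :=
  Set.indicator_of_notMem (by simpa using hy) _

theorem outerFactor_of_notMem {α τ a b : ℝ} {y : Plane} (hy : y ∉ Metric.ball (0 : Plane) b) :
    outerFactor α τ a b y = logFactor α τ a y :=
  Set.indicator_of_mem (by simpa using hy) _

theorem logFactor_mono {α τ r s : ℝ} (hα : 0 ≤ α) (hτ : 0 ≤ τ) (hr : 0 ≤ r) (hrs : r ≤ s)
    (y : Plane) : logFactor α τ r y ≤ logFactor α τ s y := by
  unfold logFactor
  refine ENNReal.ofReal_le_ofReal (Real.log_le_log (by positivity) ?_)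
  gcongr

theorem one_sub_expNeg_logFactor {α τ r : ℝ} (hτ : 0 ≤ τ) (hr : 0 ≤ r) (y : Plane) :
    1 - expNeg (logFactor α τ r y) =
      ENNReal.ofReal (τ * (r / ‖y‖) ^ α * (1 + τ * (r / ‖y‖) ^ α)⁻¹) := by
  have h : 0 ≤ τ * (r / ‖y‖) ^ α := by positivity
  rw [logFactor, expNeg_ofReal (Real.log_nonneg (by linarith)), Real.exp_neg,
    Real.exp_log (by linarith), ← ENNReal.ofReal_one, ← ENNReal.ofReal_sub _ (by positivity)]
  congr 1
  field_simp
  ring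

/-- Mean exponent of interference from outside the disc around the origin through the nearest
point, per unit area of that disc. -/
noncomputable def interfConst (α τ : ℝ) : ℝ :=
  2 * τ * ∫ y in Set.Ioi (1 : ℝ), y ^ (1 - α) * (1 + τ * y ^ (-α))⁻¹

theorem interfConst_nonneg {α τ : ℝ} (hτ : 0 ≤ τ) : 0 ≤ interfConst α τ := by
  refine mul_nonneg (by positivity) (setIntegral_nonneg measurableSet_Ioi fun y hy => ?_)
  have : (0 : ℝ) < y := lt_trans one_pos hy
  positivity

theorem integrableOn_interf {α τ : ℝ} (hα : 2 < α) (hτ : 0 ≤ τ) :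
    IntegrableOn (fun y : ℝ => y ^ (1 - α) * (1 + τ * y ^ (-α))⁻¹) (Set.Ioi 1) := by
  refine Integrable.mono' (integrableOn_rpow_one_sub hα) (by fun_prop) ?_
  filter_upwards [ae_restrict_mem measurableSet_Ioi] with y hy
  have hy0 : (0 : ℝ) < y := lt_trans one_pos hy
  rw [Real.norm_of_nonneg (by positivity)]
  refine mul_le_of_le_one_right (by positivity) (inv_le_one_of_one_le₀ ?_)
  have : 0 ≤ τ * y ^ (-α) := by positivity
  linarith

/-- Polar coordinates followed by the substitution `r = b * y`. By scaling, the dependence on `b` is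
exactly the area of the disc. -/
theorem lintegral_outerFactor {α τ b : ℝ} (hα : 2 < α) (hτ : 0 ≤ τ) (hb : 0 < b) :
    ∫⁻ y, (1 - expNeg (outerFactor α τ b b y)) =
      ENNReal.ofReal (Real.pi * b ^ 2 * interfConst α τ) := by
  let h : ℝ → ℝ := (Set.Ici b).indicator fun r => τ * (b / r) ^ α * (1 + τ * (b / r) ^ α)⁻¹
  have hpt : ∀ y : Plane, 1 - expNeg (outerFactor α τ b b y) = ENNReal.ofReal (h ‖y‖) := by
    intro y
    by_cases hy : y ∈ Metric.ball (0 : Plane) b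
    · have hy' : ‖y‖ ∉ Set.Ici b := by simpa using hy
      simp only [h]
      rw [outerFactor_of_mem hy, Set.indicator_of_notMem hy']
      simp
    · have hy' : ‖y‖ ∈ Set.Ici b := by simpa using hy
      simp only [h]
      rw [outerFactor_of_notMem hy, Set.indicator_of_mem hy', one_sub_expNeg_logFactor hτ hb.le]
  have hnn : ∀ r, 0 ≤ h r := fun r => Set.indicator_nonneg (fun r hr => by
    have : 0 < r := lt_of_lt_of_le hb hr
    positivity) r
  let q : ℝ → ℝ := fun y => y ^ (1 - α) * (1 + τ * y ^ (-α))⁻¹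
  have hq : ∀ r ∈ Set.Ioi b, r ^ (2 - 1) • h r = b * τ * q (b⁻¹ * r) := by
    intro r hr
    have hr0 : 0 < r := hb.trans hr
    have h1 : (b / r) ^ α = (b⁻¹ * r) ^ (-α) := by
      rw [Real.rpow_neg (by positivity), ← Real.inv_rpow (by positivity)]
      congr 1
      field_simp
    simp only [h, q]
    rw [Set.indicator_of_mem (show r ∈ Set.Ici b from (Set.mem_Ioi.1 hr).le), h1, sub_eq_add_neg 1 α,
      Real.rpow_add (by positivity), Real.rpow_one, smul_eq_mul, show 2 - 1 = 1 from rfl, pow_one]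
    field_simp
  have hIoi : ∀ r ∈ Set.Ioi (0 : ℝ), r ∉ Set.Ici b → r ^ (2 - 1) • h r = 0 := by
    intro r _ hr
    simp only [h]
    rw [Set.indicator_of_notMem hr, smul_zero]
  have hrank : Module.finrank ℝ Plane = 2 := by simp
  have hintq : IntegrableOn (fun r => b * τ * q (b⁻¹ * r)) (Set.Ioi b) := by
    refine Integrable.const_mul ?_ _
    rw [← IntegrableOn, integrableOn_Ioi_comp_mul_left_iff q b (by positivity),
      inv_mul_cancel₀ hb.ne']
    exact integrableOn_interf hα hτ
  have hint0 : IntegrableOn (fun r => r ^ (2 - 1) • h r) (Set.Ici b) := by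
    rw [integrableOn_Ici_iff_integrableOn_Ioi]
    exact hintq.congr_fun (fun r hr => (hq r hr).symm) measurableSet_Ioi
  have hint : Integrable (fun y : Plane => h ‖y‖) := by
    rw [integrable_fun_norm_addHaar, hrank]
    exact hint0.of_forall_sdiff_eq_zero measurableSet_Ioi fun r hr => hIoi r hr.1 hr.2
  simp only [hpt]
  rw [← ofReal_integral_eq_lintegral_ofReal hint (.of_forall fun y => hnn _)]
  congr 1
  rw [integral_fun_norm_addHaar, hrank, measureReal_def, volume_ball_plane zero_le_one,
    ENNReal.toReal_ofReal (by positivity),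
    setIntegral_eq_of_subset_of_forall_sdiff_eq_zero measurableSet_Ioi
      (Set.Ici_subset_Ioi.2 hb) fun r hr => hIoi r hr.1 hr.2,
    integral_Ici_eq_integral_Ioi, setIntegral_congr_fun measurableSet_Ioi hq, integral_const_mul,
    integral_comp_mul_left_Ioi q b (by positivity), inv_mul_cancel₀ hb.ne', inv_inv, interfConst]
  simp only [nsmul_eq_mul, smul_eq_mul]
  push_cast
  ring

/-- The two integrands differ only on the annulus, where the left one is at most `1`. -/
theorem lintegral_outerFactor_le (α τ a b : ℝ) :
    ∫⁻ y, (1 - expNeg (outerFactor α τ a a y)) ≤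
      (∫⁻ y, (1 - expNeg (outerFactor α τ a b y))) +
        volume (Metric.ball (0 : Plane) b \ Metric.ball 0 a) := by
  have hm : Measurable fun y => 1 - expNeg (outerFactor α τ a b y) :=
    measurable_const.sub (measurable_expNeg.comp (measurable_outerFactor α τ a b))
  rw [← lintegral_indicator_one (measurableSet_ball.diff measurableSet_ball),
    ← lintegral_add_left hm]
  refine lintegral_mono fun y => ?_
  by_cases ha : y ∈ Metric.ball (0 : Plane) a
  · simp [outerFactor_of_mem ha]
  · by_cases hb : y ∈ Metric.ball (0 : Plane) b
    · rw [Set.indicator_of_mem (show y ∈ _ \ _ from ⟨hb, ha⟩)]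
      exact tsub_le_self.trans le_add_self
    · rw [outerFactor_of_notMem ha, outerFactor_of_notMem hb]
      exact le_self_add

/-- Outside the unit disc `1 + ‖y‖ ≤ 2 * ‖y‖`, so the integrand is at most `2 ^ α` times `(1 + ‖y‖)
^ (-α)`, which is integrable in dimension two. -/
theorem lintegral_rpow_outer_ne_top {α : ℝ} (hα : 2 < α) :
    ∫⁻ y : Plane, (Metric.ball (0 : Plane) 1)ᶜ.indicator
      (fun y => ENNReal.ofReal (‖y‖ ^ (-α))) y ≠ ∞ := by
  have hfin := finite_integral_one_add_norm (E := Plane) (μ := volume) (r := α) (by simpa using hα)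
  refine ne_top_of_le_ne_top (ENNReal.mul_ne_top (a := ENNReal.ofReal (2 ^ α))
    ENNReal.ofReal_ne_top hfin.ne) ?_
  rw [← lintegral_const_mul _ (by fun_prop)]
  refine lintegral_mono fun y => ?_
  by_cases hy : y ∈ (Metric.ball (0 : Plane) 1)ᶜ
  swap
  · simp [Set.indicator_of_notMem hy]
  rw [Set.indicator_of_mem hy]
  have hy1 : 1 ≤ ‖y‖ := by simpa using hy
  rw [← ENNReal.ofReal_mul (by positivity)]
  refine ENNReal.ofReal_le_ofReal ?_
  rw [Real.rpow_neg (by positivity), Real.rpow_neg (by positivity), ← div_eq_mul_inv,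
    ← Real.div_rpow (by norm_num) (by positivity), ← Real.inv_rpow (by positivity)]
  refine Real.rpow_le_rpow (by positivity) ?_ (by linarith)
  rw [inv_eq_one_div, div_le_div_iff₀ (by positivity) (by positivity)]
  linarith

/-! ### The nearest point -/

theorem nearestIdx_spec {x : ℕ → Plane} (h : ∃ k, ∀ j, ‖x k‖ ≤ ‖x j‖) (j : ℕ) :
    ‖x (nearestIdx x)‖ ≤ ‖x j‖ := by
  classical
  rw [nearestIdx, dif_pos h]
  exact Nat.find_spec h j

/-- The Laplace exponent of the interference, relative to the received power, at threshold `τ`. -/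
noncomputable def interfExponent (α τ : ℝ) (x : ℕ → Plane) : ℝ≥0∞ :=
  ∑' j, if j = nearestIdx x then 0 else logFactor α τ ‖x (nearestIdx x)‖ (x j)

section Cells

variable {Ω : Type*} {X : ℕ → Ω → Plane} {ω : Ω}

theorem notMem_of_count_eq_zero {A : Set Plane} (h : count X A ω = 0) (j : ℕ) : X j ω ∉ A := by
  rw [count, Set.encard_eq_zero] at h
  exact fun hj => Set.eq_empty_iff_forall_notMem.1 h j hj

theorem nearestIdx_of_count {a b : ℝ} (h0 : count X (Metric.ball 0 a) ω = 0)
    (h1 : count X (Metric.ball 0 b \ Metric.ball 0 a) ω = 1) :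
    X (nearestIdx fun k => X k ω) ω ∈ Metric.ball (0 : Plane) b \ Metric.ball 0 a ∧
      ∀ j, j ≠ (nearestIdx fun k => X k ω) → X j ω ∉ Metric.ball (0 : Plane) b := by
  rw [count, Set.encard_eq_one] at h1
  obtain ⟨k, hk⟩ := h1
  have hkmem : X k ω ∈ Metric.ball (0 : Plane) b \ Metric.ball 0 a := by
    have : k ∈ {k | X k ω ∈ Metric.ball (0 : Plane) b \ Metric.ball 0 a} := hk ▸ rfl
    exact this
  have hout : ∀ j, j ≠ k → X j ω ∉ Metric.ball (0 : Plane) b := by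
    intro j hj hmem
    have : j ∈ {k | X k ω ∈ Metric.ball (0 : Plane) b \ Metric.ball 0 a} :=
      ⟨hmem, notMem_of_count_eq_zero h0 j⟩
    rw [hk] at this
    exact hj this
  have hkb : ‖X k ω‖ < b := by simpa using hkmem.1
  have hex : ∃ k, ∀ j, ‖X k ω‖ ≤ ‖X j ω‖ := by
    refine ⟨k, fun j => ?_⟩
    rcases eq_or_ne j k with rfl | hj
    · exact le_rfl
    · have : b ≤ ‖X j ω‖ := by simpa using hout j hj
      exact hkb.le.trans this
  have hidx : (nearestIdx fun k => X k ω) = k := by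
    by_contra hne
    have h2 : b ≤ ‖X (nearestIdx fun k => X k ω) ω‖ := by simpa using hout _ hne
    have h3 := nearestIdx_spec (x := fun k => X k ω) hex k
    exact absurd (h2.trans h3) hkb.not_ge
  rw [hidx]
  exact ⟨hkmem, hout⟩

theorem tsum_outerFactor_le_interfExponent {α τ a b : ℝ} (hα : 0 ≤ α) (hτ : 0 ≤ τ) (ha : 0 ≤ a)
    (h0 : count X (Metric.ball 0 a) ω = 0)
    (h1 : count X (Metric.ball 0 b \ Metric.ball 0 a) ω = 1) :
    ∑' j, outerFactor α τ a b (X j ω) ≤ interfExponent α τ fun k => X k ω := by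
  obtain ⟨hk, hout⟩ := nearestIdx_of_count h0 h1
  refine ENNReal.tsum_le_tsum fun j => ?_
  split_ifs with hj
  · rw [hj, outerFactor_of_mem hk.1]
  · rw [outerFactor_of_notMem (hout j hj)]
    exact logFactor_mono hα hτ ha (by simpa using hk.2) _

theorem interfExponent_le_tsum_outerFactor {α τ a b : ℝ} (hα : 0 ≤ α) (hτ : 0 ≤ τ)
    (h0 : count X (Metric.ball 0 a) ω = 0)
    (h1 : count X (Metric.ball 0 b \ Metric.ball 0 a) ω = 1) :
    (interfExponent α τ fun k => X k ω) ≤ ∑' j, outerFactor α τ b b (X j ω) := by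
  obtain ⟨hk, hout⟩ := nearestIdx_of_count h0 h1
  refine ENNReal.tsum_le_tsum fun j => ?_
  split_ifs with hj
  · exact zero_le
  · rw [outerFactor_of_notMem (hout j hj)]
    have : ‖X (nearestIdx fun k => X k ω) ω‖ < b := by simpa using hk.1
    exact logFactor_mono hα hτ (norm_nonneg _) this.le _

/-- A function that is infinite on the ball of radius `a`. -/
noncomputable def voidFactor (a : ℝ) : Plane → ℝ≥0∞ :=
  (Metric.ball (0 : Plane) a).indicator fun _ => ∞

theorem measurable_voidFactor (a : ℝ) : Measurable (voidFactor a) :=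
  measurable_const.indicator measurableSet_ball

/-- A single point in the disc makes the sum infinite, so the emptiness of the disc becomes part of
a Laplace functional. -/
theorem expNeg_tsum_voidFactor_add (a : ℝ) (f : Plane → ℝ≥0∞) :
    expNeg (∑' j, (voidFactor a (X j ω) + f (X j ω))) =
      if count X (Metric.ball 0 a) ω = 0 then expNeg (∑' j, f (X j ω)) else 0 := by
  split_ifs with h
  · congr 1
    refine tsum_congr fun j => ?_
    rw [voidFactor, Set.indicator_of_notMem (notMem_of_count_eq_zero h j), zero_add]
  · rw [count, ← Ne, Set.encard_ne_zero] at h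
    obtain ⟨k, hk⟩ := h
    rw [ENNReal.tsum_eq_top_of_eq_top ⟨k, ?_⟩, expNeg_top]
    rw [voidFactor, Set.indicator_of_mem (show X k ω ∈ Metric.ball (0 : Plane) a from hk), top_add]

/-- Indicator of the counts in `s`. -/
noncomputable def countInd (s : Set ℕ∞) : ℕ∞ → ℝ≥0∞ := s.indicator 1

theorem countInd_le_one (s : Set ℕ∞) (n : ℕ∞) : countInd s n ≤ 1 :=
  Set.indicator_le_self' (fun _ _ => zero_le) n

theorem interf_lower_bound {α τ : ℝ} (hα : 0 ≤ α) (hτ : 0 ≤ τ) {r : ℕ → ℝ} (hr : Monotone r) :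
    ∑' i, countInd {1} (count X (Metric.ball 0 (r (i + 1)) \ Metric.ball 0 (r i)) ω) *
        expNeg (∑' j, (voidFactor (r i) (X j ω) + outerFactor α τ (r (i + 1)) (r (i + 1)) (X j ω)))
      ≤ expNeg (interfExponent α τ fun k => X k ω) := by
  set u : ℕ → ℝ≥0∞ := fun i =>
    countInd {1} (count X (Metric.ball 0 (r (i + 1)) \ Metric.ball 0 (r i)) ω) *
    expNeg (∑' j, (voidFactor (r i) (X j ω) + outerFactor α τ (r (i + 1)) (r (i + 1)) (X j ω)))
    with hu
  have hE : ∀ i, u i ≠ 0 → count X (Metric.ball 0 (r i)) ω = 0 ∧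
      count X (Metric.ball 0 (r (i + 1)) \ Metric.ball 0 (r i)) ω = 1 := by
    intro i hi
    simp only [hu] at hi
    have h1 := left_ne_zero_of_mul hi
    have h2 := right_ne_zero_of_mul hi
    rw [expNeg_tsum_voidFactor_add] at h2
    refine ⟨by_contra fun h => h2 (if_neg h), by_contra fun h => h1 ?_⟩
    exact Set.indicator_of_notMem (s := ({1} : Set ℕ∞)) h _
  -- At most one term survives: a point in annulus `i` lies in the disc of radius `r j`, which must
  -- be empty for term `j`.
  have hcontra : ∀ i j, i < j → u i ≠ 0 → u j ≠ 0 → False := by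
    intro i j hij hi hj
    obtain ⟨hk, -⟩ := nearestIdx_of_count (hE i hi).1 (hE i hi).2
    exact notMem_of_count_eq_zero (hE j hj).1 _ (Metric.ball_subset_ball (hr hij) hk.1)
  by_cases hall : ∀ i, u i = 0
  · rw [ENNReal.tsum_eq_zero.2 hall]
    exact zero_le
  · push Not at hall
    obtain ⟨i, hi⟩ := hall
    rw [tsum_eq_single i]
    · obtain ⟨h0, h1⟩ := hE i hi
      rw [expNeg_tsum_voidFactor_add, if_pos h0]
      refine (mul_le_of_le_one_left zero_le (countInd_le_one _ _)).trans ?_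
      exact expNeg_antitone (interfExponent_le_tsum_outerFactor hα hτ h0 h1)
    · intro j hj
      by_contra hne
      rcases lt_or_gt_of_ne hj with h | h
      · exact hcontra j i h hne hi
      · exact hcontra i j h hi hne

theorem interf_upper_bound {α τ : ℝ} (hα : 0 ≤ α) (hτ : 0 ≤ τ) {r : ℕ → ℝ} (hr0 : r 0 = 0)
    (hr : Monotone r) (hr' : Filter.Tendsto r Filter.atTop Filter.atTop) :
    expNeg (interfExponent α τ fun k => X k ω) ≤
      ∑' i, (countInd {1} (count X (Metric.ball 0 (r (i + 1)) \ Metric.ball 0 (r i)) ω) *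
          expNeg (∑' j, (voidFactor (r i) (X j ω) + outerFactor α τ (r i) (r (i + 1)) (X j ω))) +
        countInd (Set.Ici 2) (count X (Metric.ball 0 (r (i + 1)) \ Metric.ball 0 (r i)) ω) *
          expNeg (∑' j, (voidFactor (r i) (X j ω) + 0))) := by
  classical
  -- The least such `i` labels the annulus of the nearest points. One term suffices for an upper
  -- bound; when the annulus holds several points, the left side is bounded by `1`.
  have hex : ∃ i, ∃ j, X j ω ∈ Metric.ball (0 : Plane) (r (i + 1)) := by
    obtain ⟨i, hi⟩ := (hr'.eventually_gt_atTop ‖X 0 ω‖).exists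
    exact ⟨i, 0, by simpa using hi.trans_le (hr (Nat.le_succ i))⟩
  obtain ⟨j, hj⟩ := Nat.find_spec hex
  have hmin : ∀ j, X j ω ∉ Metric.ball (0 : Plane) (r (Nat.find hex)) := by
    intro j hmem
    rcases Nat.eq_zero_or_pos (Nat.find hex) with h | h
    · rw [h, hr0] at hmem
      simp at hmem
    · refine Nat.find_min hex (Nat.sub_lt h one_pos) ⟨j, ?_⟩
      have h' : Nat.find hex - 1 + 1 = Nat.find hex := Nat.sub_add_cancel h
      simpa only [Nat.succ_eq_add_one, zero_add, h'] using hmem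
  set i := Nat.find hex
  refine le_trans ?_ (ENNReal.le_tsum i)
  have h0 : count X (Metric.ball 0 (r i)) ω = 0 := by
    rw [count, Set.encard_eq_zero]
    exact Set.eq_empty_of_forall_notMem hmin
  have h1 : count X (Metric.ball 0 (r (i + 1)) \ Metric.ball 0 (r i)) ω ≠ 0 := by
    rw [count, Set.encard_ne_zero]
    exact ⟨j, hj, hmin j⟩
  rw [expNeg_tsum_voidFactor_add, if_pos h0, expNeg_tsum_voidFactor_add _ (fun _ => 0), if_pos h0]
  by_cases h : count X (Metric.ball 0 (r (i + 1)) \ Metric.ball 0 (r i)) ω = 1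
  · refine le_trans ?_ le_self_add
    rw [countInd, Set.indicator_of_mem (by exact h), Pi.one_apply, one_mul]
    exact expNeg_antitone (tsum_outerFactor_le_interfExponent hα hτ
      (hr0 ▸ hr (Nat.zero_le i)) h0 h)
  · refine le_trans (expNeg_le_one _) (le_trans ?_ le_add_self)
    have h2 : (2 : ℕ∞) ≤ count X (Metric.ball 0 (r (i + 1)) \ Metric.ball 0 (r i)) ω := by
      have h3 := Order.add_one_le_of_lt (lt_of_le_of_ne (Order.one_le_iff_ne_zero.2 h1) (Ne.symm h))
      rwa [one_add_one_eq_two] at h3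
    rw [countInd, Set.indicator_of_mem (by exact h2)]
    simp

end Cells

/-! ### Averaging over the base stations -/

theorem lintegral_poissonMeasure_eq_one {ε : ℝ≥0} :
    ∫⁻ n : ℕ, countInd {1} n ∂poissonMeasure ε = ENNReal.ofReal (Real.exp (-ε) * ε) := by
  have : ∀ n : ℕ, countInd {1} (n : ℕ∞) = ({1} : Set ℕ).indicator 1 n := by
    intro n
    rw [countInd]
    by_cases h : n = 1 <;> simp [h]
  simp only [this]
  rw [lintegral_indicator_one (measurableSet_singleton _), poissonMeasure_singleton]
  simp

/-- From `exp (-ε) ≥ 1 - ε` one gets `1 - exp (-ε) * (1 + ε) ≤ 1 - (1 - ε) * (1 + ε) = ε ^ 2`. -/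
theorem lintegral_poissonMeasure_two_le {ε : ℝ≥0} :
    ∫⁻ n : ℕ, countInd (Set.Ici 2) n ∂poissonMeasure ε ≤ ENNReal.ofReal (ε ^ 2) := by
  have : ∀ n : ℕ, countInd (Set.Ici 2) (n : ℕ∞) = ({0, 1}ᶜ : Set ℕ).indicator 1 n := by
    intro n
    rw [countInd]
    have h2 : ((2 : ℕ∞) ≤ n) ↔ 2 ≤ n := by exact_mod_cast Iff.rfl
    by_cases h : 2 ≤ n
    · rw [Set.indicator_of_mem (show (n : ℕ∞) ∈ Set.Ici 2 from h2.2 h), Set.indicator_of_mem]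
      · rfl
      · simp
        omega
    · rw [Set.indicator_of_notMem (show (n : ℕ∞) ∉ Set.Ici 2 from fun h' => h (h2.1 h')), Set.indicator_of_notMem]
      simp
      omega
  simp only [this]
  have hprob : IsProbabilityMeasure (poissonMeasure ε) := inferInstance
  rw [lintegral_indicator_one (MeasurableSet.of_discrete), ← ofReal_measureReal,
    probReal_compl_eq_one_sub (MeasurableSet.of_discrete), Set.insert_eq,
    measureReal_union (by simp) (MeasurableSet.of_discrete),
    poissonMeasure_real_singleton, poissonMeasure_real_singleton]
  refine ENNReal.ofReal_le_ofReal ?_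
  have h1 := Real.add_one_le_exp (-(ε : ℝ))
  have h2 := ε.coe_nonneg
  simp
  nlinarith

/-- By `1 / y ≤ 1 / (1 - exp (-y)) ≤ 1 + 1 / y`, the bounds relax to `exp (-(c * ε)) / c ≤ e ≤ 1 / c
+ 2 * ε + ε ^ 2`. -/
theorem eq_one_div_of_bounds {e c : ℝ} (hc : 0 < c)
    (h : ∀ ε > 0, ε * Real.exp (-(c * ε)) / (1 - Real.exp (-(c * ε))) ≤ e ∧
      e ≤ ε / (1 - Real.exp (-(c * ε))) + ε ^ 2 / (1 - Real.exp (-ε))) : e = 1 / c := by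
  have hlow : ∀ y > 0, 0 < 1 - Real.exp (-y) := fun y hy => by
    simpa using hy
  have hinv : ∀ y > 0, 1 / (1 - Real.exp (-y)) ≤ 1 + 1 / y := by
    intro y hy
    have h1 := Real.add_one_le_exp y
    have h2 : Real.exp (-y) ≤ 1 / (1 + y) := by
      rw [Real.exp_neg, ← one_div]
      exact one_div_le_one_div_of_le (by positivity) (by linarith)
    rw [div_le_iff₀ (hlow y hy)]
    calc (1 : ℝ) = (1 + 1 / y) * (1 - 1 / (1 + y)) := by field_simp; ring
      _ ≤ _ := by gcongr
  have hinv' : ∀ y > 0, 1 / y ≤ 1 / (1 - Real.exp (-y)) := by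
    intro y hy
    have := Real.add_one_le_exp (-y)
    exact one_div_le_one_div_of_le (hlow y hy) (by linarith)
  have hu : ∀ ε > 0, e ≤ ε * (1 + 1 / (c * ε)) + ε ^ 2 * (1 + 1 / ε) := by
    intro ε hε
    refine (h ε hε).2.trans ?_
    rw [div_eq_mul_one_div ε, div_eq_mul_one_div (ε ^ 2)]
    gcongr
    exacts [hinv _ (by positivity), hinv _ hε]
  have hl : ∀ ε > 0, ε * Real.exp (-(c * ε)) * (1 / (c * ε)) ≤ e := by
    intro ε hε
    refine le_trans ?_ (h ε hε).1
    rw [div_eq_mul_one_div (ε * _)]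
    exact mul_le_mul_of_nonneg_left (hinv' _ (by positivity)) (by positivity)
  refine le_antisymm ?_ ?_
  · have hlim : Filter.Tendsto (fun ε : ℝ => 1 / c + 2 * ε + ε ^ 2) (nhdsWithin 0 (Set.Ioi 0))
        (nhds (1 / c + 2 * 0 + 0 ^ 2)) :=
      (Continuous.tendsto (by fun_prop) 0).mono_left nhdsWithin_le_nhds
    rw [show 1 / c + 2 * 0 + 0 ^ 2 = 1 / c by ring] at hlim
    refine ge_of_tendsto hlim ?_
    filter_upwards [self_mem_nhdsWithin] with ε hε
    have hε : 0 < ε := hε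
    refine (hu ε hε).trans_eq ?_
    field_simp
    ring
  · have hlim : Filter.Tendsto (fun ε : ℝ => Real.exp (-(c * ε)) / c) (nhdsWithin 0 (Set.Ioi 0))
        (nhds (Real.exp (-(c * 0)) / c)) :=
      (Continuous.tendsto (by fun_prop) 0).mono_left nhdsWithin_le_nhds
    rw [show Real.exp (-(c * 0)) / c = 1 / c by simp] at hlim
    refine le_of_tendsto hlim ?_
    filter_upwards [self_mem_nhdsWithin] with ε hε
    have hε : 0 < ε := hε
    refine le_trans (le_of_eq ?_) (hl ε hε)
    field_simp

section Average

variable {Ω : Type*} [MeasurableSpace Ω] {μ : Measure Ω} [IsProbabilityMeasure μ] {lam : ℝ}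
  {X : ℕ → Ω → Plane}

theorem lintegral_one_sub_expNeg_voidFactor_add {a : ℝ} (ha : 0 ≤ a) {f : Plane → ℝ≥0∞}
    (hf0 : ∀ y ∈ Metric.ball (0 : Plane) a, f y = 0) :
    ∫⁻ y, (1 - expNeg (voidFactor a y + f y)) =
      ENNReal.ofReal (Real.pi * a ^ 2) + ∫⁻ y, (1 - expNeg (f y)) := by
  rw [← volume_ball_plane ha, ← lintegral_indicator_one measurableSet_ball,
    ← lintegral_add_left (measurable_one.indicator measurableSet_ball)]
  refine lintegral_congr fun y => ?_
  by_cases hy : y ∈ Metric.ball (0 : Plane) a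
  · simp [voidFactor, hy, hf0 y hy]
  · simp [voidFactor, Set.indicator_of_notMem hy]

/-- Contribution of the event that the disc of radius `a` is empty. -/
theorem IsHomPoisson.lintegral_cell (hX : IsHomPoisson μ lam X) (hlam : 0 ≤ lam) {a b : ℝ}
    (ha : 0 ≤ a) (hab : a ≤ b) (s : Set ℕ∞) {f : Plane → ℝ≥0∞} (hf : Measurable f)
    (hf0 : ∀ y ∈ Metric.ball (0 : Plane) b, f y = 0) :
    ∫⁻ ω, countInd s (count X (Metric.ball 0 b \ Metric.ball 0 a) ω) *
        expNeg (∑' j, (voidFactor a (X j ω) + f (X j ω))) ∂μ =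
      (∫⁻ n : ℕ, countInd s n ∂poissonMeasure (lam * (Real.pi * (b ^ 2 - a ^ 2))).toNNReal) *
        (ENNReal.ofReal (Real.exp (-(lam * (Real.pi * a ^ 2)))) *
          expNeg (ENNReal.ofReal lam * ∫⁻ y, (1 - expNeg (f y)))) := by
  have hBm : MeasurableSet (Metric.ball (0 : Plane) b \ Metric.ball 0 a) :=
    measurableSet_ball.diff measurableSet_ball
  have hBb : Bornology.IsBounded (Metric.ball (0 : Plane) b \ Metric.ball 0 a) :=
    Metric.isBounded_ball.subset Set.sdiff_subset
  have hvol : volume.real (Metric.ball (0 : Plane) b \ Metric.ball 0 a) =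
      Real.pi * (b ^ 2 - a ^ 2) := by
    rw [measureReal_def, volume_annulus ha hab, ENNReal.toReal_ofReal]
    exact mul_nonneg Real.pi_pos.le (by nlinarith)
  rw [hX.lintegral_count_mul_expNeg hlam hBm hBb (countInd_le_one s)
    (f := fun y => voidFactor a y + f y) ((measurable_voidFactor a).add hf) (fun y hy => ?_),
    hX.lintegral_count hBm hBb, hvol, lintegral_one_sub_expNeg_voidFactor_add ha
    (fun y hy => hf0 y (Metric.ball_subset_ball hab hy)), mul_add, expNeg_add,
    ← ENNReal.ofReal_mul hlam, expNeg_ofReal (by positivity)]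
  rw [hf0 y hy.1, voidFactor, Set.indicator_of_notMem hy.2, add_zero]

end Average

theorem tsum_ofReal_geometric {c q : ℝ} (hc : 0 ≤ c) (hq0 : 0 ≤ q) (hq1 : q < 1) :
    ∑' i : ℕ, ENNReal.ofReal (c * q ^ i) = ENNReal.ofReal (c / (1 - q)) := by
  have h := (hasSum_geometric_of_lt_one hq0 hq1).mul_left c
  rw [← ENNReal.ofReal_tsum_of_nonneg (fun i => by positivity) h.summable, h.tsum_eq,
    div_eq_mul_inv]

/-- Radii of concentric discs such that a Poisson process of density `lam` has on average `ε`
points between consecutive ones. -/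
noncomputable def cellRadius (lam ε : ℝ) (i : ℕ) : ℝ := √(i * ε / (lam * Real.pi))

section Radii

variable {lam ε : ℝ}

theorem cellRadius_zero : cellRadius lam ε 0 = 0 := by simp [cellRadius]

theorem cellRadius_nonneg (i : ℕ) : 0 ≤ cellRadius lam ε i := Real.sqrt_nonneg _

theorem cellRadius_sq (hlam : 0 < lam) (hε : 0 < ε) (i : ℕ) :
    lam * (Real.pi * cellRadius lam ε i ^ 2) = i * ε := by
  have := Real.pi_pos
  rw [cellRadius, Real.sq_sqrt (by positivity)]
  field_simp

theorem cellRadius_mono (hlam : 0 < lam) (hε : 0 < ε) : Monotone (cellRadius lam ε) := by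
  intro i j hij
  have := Real.pi_pos
  have : (i : ℝ) ≤ j := by exact_mod_cast hij
  unfold cellRadius
  gcongr

theorem cellRadius_pos (hlam : 0 < lam) (hε : 0 < ε) {i : ℕ} (hi : 0 < i) :
    0 < cellRadius lam ε i := by
  have := Real.pi_pos
  have : (0 : ℝ) < i := by exact_mod_cast hi
  exact Real.sqrt_pos.2 (by positivity)

theorem tendsto_cellRadius (hlam : 0 < lam) (hε : 0 < ε) :
    Filter.Tendsto (cellRadius lam ε) Filter.atTop Filter.atTop := by
  have := Real.pi_pos
  refine Real.tendsto_sqrt_atTop.comp ?_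
  exact (tendsto_natCast_atTop_atTop.atTop_mul_const hε).atTop_div_const (by positivity)

end Radii

section Average

variable {Ω : Type*} [MeasurableSpace Ω] {μ : Measure Ω} [IsProbabilityMeasure μ] {lam : ℝ}
  {X : ℕ → Ω → Plane} {α τ ε : ℝ}

theorem expNeg_lam_mul_lintegral_outerFactor (hlam : 0 < lam) (hε : 0 < ε) (hα : 2 < α)
    (hτ : 0 ≤ τ) {i : ℕ} (hi : 0 < i) :
    expNeg (ENNReal.ofReal lam * ∫⁻ y, (1 - expNeg (outerFactor α τ (cellRadius lam ε i)
      (cellRadius lam ε i) y))) = ENNReal.ofReal (Real.exp (-(i * ε * interfConst α τ))) := by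
  have hρ := interfConst_nonneg (α := α) hτ
  rw [lintegral_outerFactor hα hτ (cellRadius_pos hlam hε hi), ← ENNReal.ofReal_mul hlam.le,
    ← mul_assoc, cellRadius_sq hlam hε, expNeg_ofReal (by positivity)]

/-- The factor `exp (-ε)` from the probability of exactly one point in the annulus pays for the
annulus missing from the integral. For `i = 0` the radius vanishes, and the claim is the trivial
bound by `1`. -/
theorem expNeg_lam_mul_lintegral_outerFactor_le (hlam : 0 < lam) (hε : 0 < ε) (hα : 2 < α)
    (hτ : 0 ≤ τ) (i : ℕ) :
    ENNReal.ofReal (Real.exp (-ε)) *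
      expNeg (ENNReal.ofReal lam * ∫⁻ y, (1 - expNeg (outerFactor α τ (cellRadius lam ε i)
        (cellRadius lam ε (i + 1)) y))) ≤
      ENNReal.ofReal (Real.exp (-(i * ε * interfConst α τ))) := by
  rcases Nat.eq_zero_or_pos i with rfl | hi
  · refine (mul_le_one' ?_ (expNeg_le_one _)).trans (by simp)
    simpa using hε.le
  · rw [← expNeg_lam_mul_lintegral_outerFactor hlam hε hα hτ hi, ← expNeg_ofReal hε.le,
      ← expNeg_add]
    refine expNeg_antitone ((mul_le_mul_right (lintegral_outerFactor_le α τ _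
      (cellRadius lam ε (i + 1))) _).trans_eq ?_)
    rw [volume_annulus (cellRadius_nonneg i) (cellRadius_mono hlam hε (Nat.le_succ i)), mul_add,
      add_comm, ← ENNReal.ofReal_mul hlam.le]
    congr 2
    rw [mul_sub, mul_sub, cellRadius_sq hlam hε, cellRadius_sq hlam hε]
    push_cast
    ring

theorem annulus_mean (hlam : 0 < lam) (hε : 0 < ε) (i : ℕ) :
    lam * (Real.pi * (cellRadius lam ε (i + 1) ^ 2 - cellRadius lam ε i ^ 2)) = ε := by
  rw [mul_sub, mul_sub, cellRadius_sq hlam hε, cellRadius_sq hlam hε]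
  push_cast
  ring

theorem IsHomPoisson.le_lintegral_expNeg_interfExponent (hX : IsHomPoisson μ lam X)
    (hlam : 0 < lam) (hα : 2 < α) (hτ : 0 ≤ τ) (hε : 0 < ε) :
    ENNReal.ofReal (ε * Real.exp (-((1 + interfConst α τ) * ε)) /
        (1 - Real.exp (-((1 + interfConst α τ) * ε)))) ≤
      ∫⁻ ω, expNeg (interfExponent α τ fun k => X k ω) ∂μ := by
  have hρ := interfConst_nonneg (α := α) hτ
  set r := cellRadius lam ε with hr
  have hmono : Monotone r := cellRadius_mono hlam hε
  refine le_trans (le_of_eq ?_) (lintegral_mono fun ω =>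
    interf_lower_bound (X := X) (ω := ω) (by linarith) hτ hmono)
  rw [lintegral_tsum fun i => ?_, ← tsum_ofReal_geometric (by positivity) (Real.exp_pos _).le
    (by simpa using (by positivity : 0 < (1 + interfConst α τ) * ε))]
  -- Term `i` is `ε * exp (-(c * (i + 1) * ε))` with `c = 1 + interfConst α τ`; the shift by one
  -- comes from the outer radius and leaves the extra factor `exp (-(c * ε))`.
  · refine tsum_congr fun i => ?_
    rw [hX.lintegral_cell hlam.le (cellRadius_nonneg i) (hmono (Nat.le_succ i)) {1}
      (measurable_outerFactor _ _ _ _) (fun y hy => outerFactor_of_mem hy),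
      lintegral_poissonMeasure_eq_one, hr,
      expNeg_lam_mul_lintegral_outerFactor hlam hε hα hτ (Nat.succ_pos i), annulus_mean hlam hε,
      cellRadius_sq hlam hε, Real.coe_toNNReal _ hε.le, ← ENNReal.ofReal_mul (by positivity),
      ← ENNReal.ofReal_mul (by positivity)]
    congr 1
    rw [← Real.exp_nat_mul, mul_assoc ε, ← Real.exp_add, ← Real.exp_add, mul_right_comm, mul_comm,
      ← Real.exp_add]
    congr 2
    push_cast
    ring
  · refine ((measurable_from_top.comp (measurable_count hX.measurable
      (measurableSet_ball.diff measurableSet_ball))).mul (measurable_expNeg.comp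
      (measurable_tsum_ennreal fun j => ?_))).aemeasurable
    exact ((measurable_voidFactor _).add (measurable_outerFactor _ _ _ _)).comp (hX.measurable j)

theorem IsHomPoisson.lintegral_expNeg_interfExponent_le (hX : IsHomPoisson μ lam X)
    (hlam : 0 < lam) (hα : 2 < α) (hτ : 0 ≤ τ) (hε : 0 < ε) :
    ∫⁻ ω, expNeg (interfExponent α τ fun k => X k ω) ∂μ ≤
      ENNReal.ofReal (ε / (1 - Real.exp (-((1 + interfConst α τ) * ε))) +
        ε ^ 2 / (1 - Real.exp (-ε))) := by
  have hρ := interfConst_nonneg (α := α) hτ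
  set r := cellRadius lam ε with hr
  have hmono : Monotone r := cellRadius_mono hlam hε
  have hcount : ∀ (s : Set ℕ∞) i, Measurable fun ω =>
      countInd s (count X (Metric.ball 0 (r (i + 1)) \ Metric.ball 0 (r i)) ω) := fun s i =>
    measurable_from_top.comp (measurable_count hX.measurable
      (measurableSet_ball.diff measurableSet_ball))
  have hm1 : ∀ i, Measurable fun ω =>
      countInd {1} (count X (Metric.ball 0 (r (i + 1)) \ Metric.ball 0 (r i)) ω) *
        expNeg (∑' j, (voidFactor (r i) (X j ω) + outerFactor α τ (r i) (r (i + 1)) (X j ω))) :=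
    fun i => (hcount _ i).mul (measurable_expNeg.comp (measurable_tsum_ennreal fun j =>
      ((measurable_voidFactor _).add (measurable_outerFactor _ _ _ _)).comp (hX.measurable j)))
  have hm2 : ∀ i, Measurable fun ω =>
      countInd (Set.Ici 2) (count X (Metric.ball 0 (r (i + 1)) \ Metric.ball 0 (r i)) ω) *
        expNeg (∑' j, (voidFactor (r i) (X j ω) + 0)) :=
    fun i => (hcount _ i).mul (measurable_expNeg.comp (measurable_tsum_ennreal fun j =>
      ((measurable_voidFactor _).add measurable_const).comp (hX.measurable j)))
  refine (lintegral_mono fun ω => interf_upper_bound (X := X) (ω := ω) (α := α) (r := r) (by linarith)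
    hτ cellRadius_zero hmono (tendsto_cellRadius hlam hε)).trans ?_
  have hlt : ∀ y > 0, Real.exp (-y) < 1 := fun y hy => by simpa using hy
  have hcε : 0 < (1 + interfConst α τ) * ε := by positivity
  rw [lintegral_tsum fun i => by exact ((hm1 i).add (hm2 i)).aemeasurable,
    ENNReal.ofReal_add (div_nonneg hε.le (sub_nonneg.2 (hlt _ hcε).le))
      (div_nonneg (by positivity) (sub_nonneg.2 (hlt _ hε).le)),
    ← tsum_ofReal_geometric hε.le (Real.exp_pos _).le (hlt _ hcε),
    ← tsum_ofReal_geometric (by positivity) (Real.exp_pos _).le (hlt _ hε), ← ENNReal.tsum_add]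
  refine ENNReal.tsum_le_tsum fun i => ?_
  rw [lintegral_add_left (hm1 i)]
  refine add_le_add ?_ ?_
  · rw [hX.lintegral_cell hlam.le (cellRadius_nonneg i) (hmono (Nat.le_succ i)) {1}
      (measurable_outerFactor _ _ _ _) (fun y hy => outerFactor_of_mem hy),
      lintegral_poissonMeasure_eq_one, hr, annulus_mean hlam hε,
      cellRadius_sq hlam hε, Real.coe_toNNReal _ hε.le, ENNReal.ofReal_mul (Real.exp_pos _).le]
    calc _ = ENNReal.ofReal ε * ENNReal.ofReal (Real.exp (-(i * ε))) *
          (ENNReal.ofReal (Real.exp (-ε)) * expNeg (ENNReal.ofReal lam *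
            ∫⁻ y, (1 - expNeg (outerFactor α τ (cellRadius lam ε i)
              (cellRadius lam ε (i + 1)) y)))) := by ring
      _ ≤ ENNReal.ofReal ε * ENNReal.ofReal (Real.exp (-(i * ε))) *
          ENNReal.ofReal (Real.exp (-(i * ε * interfConst α τ))) := by
        gcongr
        exact expNeg_lam_mul_lintegral_outerFactor_le hlam hε hα hτ i
      _ = _ := by
        rw [← ENNReal.ofReal_mul hε.le, ← ENNReal.ofReal_mul (by positivity)]
        congr 1
        rw [← Real.exp_nat_mul, mul_assoc ε, ← Real.exp_add]
        congr 2
        ring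
  · have h := hX.lintegral_cell hlam.le (cellRadius_nonneg (lam := lam) (ε := ε) i)
      (hmono (Nat.le_succ i)) (Set.Ici 2) (f := fun _ => 0) measurable_const (fun _ _ => rfl)
    simp only [expNeg_zero, tsub_self, lintegral_zero, mul_zero, mul_one] at h
    rw [hr]
    refine (le_of_eq h).trans ?_
    rw [annulus_mean hlam hε, cellRadius_sq hlam hε, ENNReal.ofReal_mul (by positivity)]
    refine mul_le_mul' (lintegral_poissonMeasure_two_le.trans_eq ?_) (le_of_eq ?_)
    · rw [Real.coe_toNNReal _ hε.le]
    · rw [← Real.exp_nat_mul]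
      congr 2
      ring

/-- Laplace functional of the interference as seen from the nearest point of a Poisson process. -/
theorem IsHomPoisson.lintegral_expNeg_interfExponent (hX : IsHomPoisson μ lam X)
    (hlam : 0 < lam) (hα : 2 < α) (hτ : 0 ≤ τ) :
    (∫⁻ ω, expNeg (interfExponent α τ fun k => X k ω) ∂μ).toReal =
      1 / (1 + interfConst α τ) := by
  have hρ := interfConst_nonneg (α := α) hτ
  have hfin : ∫⁻ ω, expNeg (interfExponent α τ fun k => X k ω) ∂μ ≠ ∞ :=
    ((lintegral_mono fun ω => expNeg_le_one _).trans_lt (by simp)).ne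
  refine eq_one_div_of_bounds (by linarith) fun ε hε => ⟨?_, ?_⟩
  · exact (ENNReal.ofReal_le_iff_le_toReal hfin).1
      (hX.le_lintegral_expNeg_interfExponent hlam hα hτ hε)
  · refine ENNReal.toReal_le_of_le_ofReal ?_
      (hX.lintegral_expNeg_interfExponent_le hlam hα hτ hε)
    have h1 : Real.exp (-((1 + interfConst α τ) * ε)) ≤ 1 := by
      simpa using (by positivity : 0 ≤ (1 + interfConst α τ) * ε)
    have h2 : Real.exp (-ε) ≤ 1 := by simpa using hε.le
    exact add_nonneg (div_nonneg hε.le (sub_nonneg.2 h1))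
      (div_nonneg (by positivity) (sub_nonneg.2 h2))

end Average

/-! ### Measurability of the SINR -/

theorem measurable_nearestIdx : Measurable nearestIdx := by
  classical
  have hP : ∀ k, MeasurableSet {x : ℕ → Plane | ∀ j, ‖x k‖ ≤ ‖x j‖} := by
    intro k
    have : {x : ℕ → Plane | ∀ j, ‖x k‖ ≤ ‖x j‖} = ⋂ j, {x | ‖x k‖ ≤ ‖x j‖} := by
      ext x
      simp
    rw [this]
    exact MeasurableSet.iInter fun j => measurableSet_le (by fun_prop) (by fun_prop)
  have hex : MeasurableSet {x : ℕ → Plane | ∃ k, ∀ j, ‖x k‖ ≤ ‖x j‖} := by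
    have : {x : ℕ → Plane | ∃ k, ∀ j, ‖x k‖ ≤ ‖x j‖} = ⋃ k, {x | ∀ j, ‖x k‖ ≤ ‖x j‖} := by
      ext x
      simp
    rw [this]
    exact MeasurableSet.iUnion hP
  refine measurable_to_countable' fun n => ?_
  -- The second part of the union records the default index `0` for configurations without a nearest
  -- point.
  have : nearestIdx ⁻¹' {n} =
      ({x : ℕ → Plane | ∀ j, ‖x n‖ ≤ ‖x j‖} ∩ ⋂ m < n, {x | ∀ j, ‖x m‖ ≤ ‖x j‖}ᶜ) ∪
        ({x : ℕ → Plane | ∃ k, ∀ j, ‖x k‖ ≤ ‖x j‖}ᶜ ∩ {_x | n = 0}) := by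
    ext x
    simp only [Set.mem_preimage, Set.mem_singleton_iff, Set.mem_union, Set.mem_inter_iff,
      Set.mem_iInter, Set.mem_compl_iff, Set.mem_ofPred_eq]
    by_cases h : ∃ k, ∀ j, ‖x k‖ ≤ ‖x j‖
    · rw [nearestIdx, dif_pos h, Nat.find_eq_iff]
      simp only [h, not_true_eq_false, false_and, or_false]
    · rw [nearestIdx, dif_neg h]
      have h' : ¬ ∀ j, ‖x n‖ ≤ ‖x j‖ := fun hn => h ⟨n, hn⟩
      simp only [h, h', not_false_eq_true, true_and, false_and, false_or]
      exact eq_comm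
  rw [this]
  exact ((hP n).inter (MeasurableSet.iInter fun m => MeasurableSet.iInter fun _ =>
    (hP m).compl)).union (hex.compl.inter (MeasurableSet.const _))

theorem measurable_apply_nearestIdx {β : Type*} [MeasurableSpace β]
    {F : ℕ → (ℕ → Plane) × (ℕ → ℝ) → β} (hF : ∀ k, Measurable (F k)) :
    Measurable fun p : (ℕ → Plane) × (ℕ → ℝ) => F (nearestIdx p.1) p := by
  have h : Measurable fun q : ℕ × ((ℕ → Plane) × (ℕ → ℝ)) => F q.1 q.2 :=
    measurable_from_prod_countable_right hF
  exact h.comp ((measurable_nearestIdx.comp measurable_fst).prodMk measurable_id)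

theorem MacroTier.measurable_gain (T : MacroTier) : Measurable T.gain := by
  unfold gain pathLoss
  fun_prop

theorem MacroTier.measurable_sinr (T : MacroTier) :
    Measurable fun p : (ℕ → Plane) × (ℕ → ℝ) => T.sinr p.1 p.2 := by
  have hg := T.measurable_gain
  have h1 : ∀ k, Measurable fun p : (ℕ → Plane) × (ℕ → ℝ) =>
      ENNReal.ofReal (T.rxPower (p.1 k) (p.2 k)) := by
    intro k
    simp only [rxPower_eq]
    fun_prop
  have h2 : Measurable fun p : (ℕ → Plane) × (ℕ → ℝ) => T.interference p.1 p.2 := by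
    refine measurable_tsum_ennreal fun k => Measurable.ite ?_ measurable_const (h1 k)
    exact measurableSet_eq_fun measurable_const (measurable_nearestIdx.comp measurable_fst)
  exact ((measurable_apply_nearestIdx h1).div (measurable_const.add h2)).ennreal_toReal

/-! ### Coverage probabilities -/

section Coverage

variable {Ω : Type*} [MeasurableSpace Ω] {μ : Measure Ω} [IsProbabilityMeasure μ] {lam : ℝ}
  {X : ℕ → Ω → Plane} {g : ℕ → Ω → ℝ}

/-- The function equal to `∞` at the origin and `0` elsewhere has integral `0`, so its sum over the
points is almost surely finite. -/
theorem IsHomPoisson.ae_ne_zero (hX : IsHomPoisson μ lam X) (hlam : 0 ≤ lam) :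
    ∀ᵐ ω ∂μ, ∀ k, X k ω ≠ 0 := by
  have hm : Measurable (({0} : Set Plane).indicator fun _ => (∞ : ℝ≥0∞)) :=
    measurable_const.indicator (measurableSet_singleton 0)
  filter_upwards [hX.ae_tsum_ne_top hlam hm
    (by rw [lintegral_indicator (measurableSet_singleton 0)]; simp)] with ω hω k hk
  refine hω (ENNReal.tsum_eq_top_of_eq_top ⟨k, ?_⟩)
  simp [hk]

/-- The path loss is not integrable near the origin, so the unit disc is treated separately: it
almost surely contains finitely many points. Outside it the path loss is integrable. -/
theorem IsHomPoisson.ae_tsum_gain_ne_top (hX : IsHomPoisson μ lam X) (hlam : 0 ≤ lam)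
    (T : MacroTier) : ∀ᵐ ω ∂μ, ∑' k, ENNReal.ofReal (T.gain (X k ω)) ≠ ∞ := by
  let B : Set Plane := Metric.ball 0 1
  let h : Plane → ℝ≥0∞ := fun y => ENNReal.ofReal (‖y‖ ^ (-T.pathExp))
  have hB : MeasurableSet B := measurableSet_ball
  have hh : Measurable h := by fun_prop
  have hgain : ∀ y, ENNReal.ofReal (T.gain y) =
      ENNReal.ofReal (T.power * T.intercept * T.antennas) *
        (B.indicator h y + Bᶜ.indicator h y) := by
    intro y
    have := T.power_pos
    have := T.intercept_pos
    rw [Set.indicator_self_add_compl_apply, ← ENNReal.ofReal_mul (by positivity),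
      MacroTier.gain, MacroTier.pathLoss]
    congr 1
    ring
  filter_upwards [hX.ae_tsum_ne_top hlam (measurable_one.indicator hB)
    (by rw [lintegral_indicator_one hB]; exact measure_ball_lt_top.ne),
    hX.ae_tsum_ne_top hlam (hh.indicator hB.compl)
      (lintegral_rpow_outer_ne_top T.two_lt_pathExp)] with ω h1 h2
  simp only [hgain, ENNReal.tsum_mul_left, ENNReal.tsum_add]
  refine ENNReal.mul_ne_top ENNReal.ofReal_ne_top (ENNReal.add_ne_top.2 ⟨?_, h2⟩)
  have hfin : {k | X k ω ∈ B}.Finite := by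
    rw [← Set.encard_ne_top_iff]
    have h3 := tsum_indicator_eq_count (X := X) B ω
    intro htop
    rw [count, htop] at h3
    exact h1 h3
  rw [tsum_eq_sum (s := hfin.toFinset) fun k hk => Set.indicator_of_notMem (by simpa using hk) _]
  refine ENNReal.sum_ne_top.2 fun k _ => ?_
  by_cases hk : X k ω ∈ B
  · rw [Set.indicator_of_mem hk]
    exact ENNReal.ofReal_ne_top
  · simp [Set.indicator_of_notMem hk]

variable {T : MacroTier}

theorem ae_sinr_process_pos (hX : IsHomPoisson μ T.density X) (hg : IsRayleighFading μ g)
    (hXg : IndepFun (fun ω k => X k ω) (fun ω k => g k ω) μ) :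
    ∀ᵐ ω ∂μ, 0 < T.sinr (fun k => X k ω) fun k => g k ω := by
  have hS : MeasurableSet {p : (ℕ → Plane) × (ℕ → ℝ) | ¬ 0 < T.sinr p.1 p.2} :=
    (measurableSet_lt measurable_const T.measurable_sinr).compl
  have h := measure_setOf_prodMk_mem (measurable_pi_lambda _ hX.measurable)
    (measurable_pi_lambda _ hg.measurable) hXg hS
  rw [ae_iff]
  refine h.trans ((lintegral_congr_ae ?_).trans lintegral_zero)
  filter_upwards [hX.ae_ne_zero T.density_pos.le, hX.ae_tsum_gain_ne_top T.density_pos.le T]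
    with ω h1 h2
  exact ae_iff.1 (ae_sinr_pos hg T h1 h2)

theorem measure_sinr_process_eq (hX : IsHomPoisson μ T.density X) (hg : IsRayleighFading μ g)
    (hXg : IndepFun (fun ω k => X k ω) (fun ω k => g k ω) μ) {τ : ℝ} (hτ : 0 < τ) :
    μ {ω | T.sinr (fun k => X k ω) (fun k => g k ω) = τ} = 0 := by
  have hS : MeasurableSet {p : (ℕ → Plane) × (ℕ → ℝ) | T.sinr p.1 p.2 = τ} :=
    T.measurable_sinr (measurableSet_singleton τ)
  have h := measure_setOf_prodMk_mem (measurable_pi_lambda _ hX.measurable)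
    (measurable_pi_lambda _ hg.measurable) hXg hS
  refine h.trans ((lintegral_congr_ae ?_).trans lintegral_zero)
  filter_upwards [hX.ae_ne_zero T.density_pos.le] with ω h1
  exact measure_sinr_eq hg T h1 hτ

/-- The distribution of the SINR has no atoms. -/
theorem measureReal_le_sinr (hX : IsHomPoisson μ T.density X) (hg : IsRayleighFading μ g)
    (hXg : IndepFun (fun ω k => X k ω) (fun ω k => g k ω) μ) {τ : ℝ} (hτ : 0 ≤ τ) :
    μ.real {ω | τ ≤ T.sinr (fun k => X k ω) fun k => g k ω} = macroCoverage μ T X g τ := by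
  refine measureReal_congr ?_
  have hne : ∀ᵐ ω ∂μ, T.sinr (fun k => X k ω) (fun k => g k ω) ≠ τ := by
    rcases hτ.eq_or_lt with rfl | hτ
    · filter_upwards [ae_sinr_process_pos hX hg hXg] with ω hω
      exact hω.ne'
    · simpa [ae_iff] using measure_sinr_process_eq hX hg hXg hτ
  filter_upwards [hne] with ω hω
  exact propext ⟨fun h => lt_of_le_of_ne h hω.symm, fun h => le_of_lt h⟩

theorem macroCoverage_eq (hX : IsHomPoisson μ T.density X) (hg : IsRayleighFading μ g)
    (hXg : IndepFun (fun ω k => X k ω) (fun ω k => g k ω) μ) (hT : T.noise = 0) {τ : ℝ}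
    (hτ : 0 ≤ τ) : macroCoverage μ T X g τ = macroCoverageFormula T.pathExp 1 τ := by
  have hα := T.two_lt_pathExp
  have hform : macroCoverageFormula T.pathExp 1 τ = 1 / (1 + interfConst T.pathExp τ) := by
    rw [macroCoverageFormula, pathS_eq_integral hα hτ, interfConst]
    simp
  rw [hform]
  -- At `τ = 0` both sides are `1`, by almost sure positivity of the SINR; the pointwise formula
  -- needs `τ > 0`.
  rcases hτ.eq_or_lt with rfl | hτ
  · have : macroCoverage μ T X g 0 = μ.real Set.univ :=
      measureReal_congr (by
        filter_upwards [ae_sinr_process_pos hX hg hXg] with ω hω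
        exact propext ⟨fun _ => trivial, fun _ => hω⟩)
    rw [this]
    simp [interfConst]
  · rw [← hX.lintegral_expNeg_interfExponent T.density_pos hα hτ.le, macroCoverage,
      measureReal_def]
    congr 1
    have hS : MeasurableSet {p : (ℕ → Plane) × (ℕ → ℝ) | τ < T.sinr p.1 p.2} :=
      measurableSet_lt measurable_const T.measurable_sinr
    refine (measure_setOf_prodMk_mem (measurable_pi_lambda _ hX.measurable)
      (measurable_pi_lambda _ hg.measurable) hXg hS).trans (lintegral_congr_ae ?_)
    filter_upwards [hX.ae_ne_zero T.density_pos.le] with ω h1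
    exact measure_lt_sinr hg hT h1 hτ

/-! ### Server mode -/

theorem measureReal_request {δ : ℝ} {Hc Nc : ℕ} {F : Ω → ℕ} (hF : IsZipfRequest μ δ Nc F) :
    μ.real {ω | Hc < F ω ∧ F ω ≤ Nc} = ∑ f ∈ Finset.Icc (Hc + 1) Nc, zipf δ Nc f := by
  have hset : {ω | Hc < F ω ∧ F ω ≤ Nc} = F ⁻¹' (Finset.Icc (Hc + 1) Nc : Set ℕ) := by
    ext ω
    simp
  rw [hset, ← sum_measureReal_preimage_singleton _ fun f _ =>
    hF.measurable (measurableSet_singleton f)]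
  refine Finset.sum_congr rfl fun f hf => ?_
  rw [← hF.law f (Finset.Icc_subset_Icc_left (Nat.le_add_left 1 Hc) hf)]
  rfl

theorem MacroTier.sinr_nonneg (T : MacroTier) (x : ℕ → Plane) (t : ℕ → ℝ) : 0 ≤ T.sinr x t :=
  ENNReal.toReal_nonneg

theorem MacroTier.le_serverRate_iff (T : MacroTier) {B : ℝ} (hB : 0 < B) (Cbh Rth : ℝ)
    (x : ℕ → Plane) (t : ℕ → ℝ) :
    Rth ≤ T.serverRate B Cbh x t ↔ (2 : ℝ) ^ (Rth / B) - 1 ≤ T.sinr x t ∧ Rth ≤ Cbh := by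
  have h := T.sinr_nonneg x t
  rw [serverRate, le_min_iff, mul_comm, ← div_le_iff₀ hB,
    Real.le_logb_iff_rpow_le one_lt_two (by linarith), sub_le_iff_le_add, add_comm]

theorem serverSuccess_eq {δ B Cbh Rth : ℝ} {Hc Nc : ℕ} {F : Ω → ℕ} (hB : 0 < B)
    (hX : IsHomPoisson μ T.density X) (hg : IsRayleighFading μ g) (hF : IsZipfRequest μ δ Nc F)
    (hXg : IndepFun (fun ω k => X k ω) (fun ω k => g k ω) μ)
    (hFXg : IndepFun F (fun ω => ((fun k => X k ω), (fun k => g k ω))) μ) (hR : 0 ≤ Rth) :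
    serverSuccess μ T B Cbh Hc Nc X g F Rth =
      unitStep (Cbh - Rth) * unitStep ((Nc : ℝ) - (Hc : ℝ) - 1) *
        ∑ f ∈ Finset.Icc (Hc + 1) Nc,
          zipf δ Nc f * macroCoverage μ T X g ((2 : ℝ) ^ (Rth / B) - 1) := by
  have hτ : (0 : ℝ) ≤ 2 ^ (Rth / B) - 1 :=
    sub_nonneg.2 (Real.one_le_rpow one_le_two (by positivity))
  set τ : ℝ := 2 ^ (Rth / B) - 1 with hτdef
  have hset : {ω | (Hc < F ω ∧ F ω ≤ Nc) ∧
      Rth ≤ T.serverRate B Cbh (fun k => X k ω) fun k => g k ω} =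
      {ω | (Hc < F ω ∧ F ω ≤ Nc) ∧ τ ≤ T.sinr (fun k => X k ω) (fun k => g k ω) ∧ Rth ≤ Cbh} := by
    ext ω
    simp only [Set.mem_ofPred_eq, T.le_serverRate_iff hB, hτdef]
  -- This step factor is redundant: when it vanishes the range of summation is empty.
  have hstep : unitStep ((Nc : ℝ) - (Hc : ℝ) - 1) *
      ∑ f ∈ Finset.Icc (Hc + 1) Nc, zipf δ Nc f * macroCoverage μ T X g τ =
      (∑ f ∈ Finset.Icc (Hc + 1) Nc, zipf δ Nc f) * macroCoverage μ T X g τ := by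
    rw [← Finset.sum_mul]
    rcases le_or_gt (Hc + 1) Nc with h | h
    · have h' : (Hc : ℝ) + 1 ≤ Nc := by exact_mod_cast h
      rw [unitStep, if_pos (by linarith), one_mul]
    · rw [Finset.Icc_eq_empty_of_lt h]
      simp
  rw [serverSuccess, hset, mul_assoc, hstep]
  rcases le_or_gt Rth Cbh with hC | hC
  · rw [unitStep, if_pos (by linarith), one_mul, ← measureReal_request hF,
      ← measureReal_le_sinr hX hg hXg hτ]
    simp only [hC, and_true]
    have hind := hFXg.measure_inter_preimage_eq_mul {f | Hc < f ∧ f ≤ Nc}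
      {p : (ℕ → Plane) × (ℕ → ℝ) | τ ≤ T.sinr p.1 p.2} MeasurableSet.of_discrete
      (measurableSet_le measurable_const T.measurable_sinr)
    have := congrArg ENNReal.toReal hind
    rw [ENNReal.toReal_mul] at this
    exact this
  · rw [unitStep, if_neg (by linarith), zero_mul]
    simp [hC.not_ge]

end Coverage

end CacheHetNet

theorem lemma4 {Ω : Type*} [MeasurableSpace Ω] (μ : Measure Ω) [IsProbabilityMeasure μ]
    (T : MacroTier) (Nc Hc : ℕ) (hHc : Hc ≤ Nc) (δ : ℝ) (hδ : 0 ≤ δ)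
    (B₁ Cbh : ℝ) (hB : 0 < B₁)
    (X : ℕ → Ω → Plane) (g : ℕ → Ω → ℝ) (F : Ω → ℕ)
    (hX : IsHomPoisson μ T.density X) (hg : IsRayleighFading μ g)
    (hF : IsZipfRequest μ δ Nc F)
    (hXg : IndepFun (fun ω k => X k ω) (fun ω k => g k ω) μ)
    (hFXg : IndepFun F (fun ω => ((fun k => X k ω), (fun k => g k ω))) μ) :
    (∀ Rth : ℝ, 0 ≤ Rth →
      serverSuccess μ T B₁ Cbh Hc Nc X g F Rth =
        unitStep (Cbh - Rth) * unitStep ((Nc : ℝ) - (Hc : ℝ) - 1) *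
          ∑ f ∈ Finset.Icc (Hc + 1) Nc,
            zipf δ Nc f * macroCoverage μ T X g ((2 : ℝ) ^ (Rth / B₁) - 1)) ∧
    (T.noise = 0 → ∀ τ : ℝ, 0 ≤ τ →
      macroCoverage μ T X g τ = macroCoverageFormula T.pathExp 1 τ) :=
  ⟨fun _ hR => serverSuccess_eq hB hX hg hF hXg hFXg hR,
    fun hT _ hτ => macroCoverage_eq hX hg hXg hT hτ⟩
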